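/- **Theorem.** Let $M,N\ge 1$, let $\mathscr A$ be a nonempty finite set of $M\times N$ matrices and $\mathscr E$ a nonempty finite set of $N\times M$ matrices, all with non-negative integer entries. In the matrix multiplication game (MMG) on $(\mathscr A,\mathscr E)$, in rounds $i=1,2,\dots$ Adam writes a matrix $A_i\in\mathscr A$ and then Eve writes a matrix $E_i\in\mathscr E$, each choice being made as a function of the finite history of the play. Thus a strategy of Adam is a map $\sigma:(\mathscr A\cdot\mathscr E)^*\to\mathscr A$ and a strategy of Eve is a map $\tau:(\mathscr A\cdot\mathscr E)^*\cdot\mathscr A\to\mathscr E$. A pair $(\sigma,\tau)$ determines a unique play $A_1E_1A_2E_2\cdots$, whose payoff (paid by Adam to Eve) is $$P(\sigma,\tau)=\limsup_{k\to\infty}\Big\|\prod_{i=1}^k A_iE_i\Big\|^{1/k},$$ where $\|\cdot\|$ is the sum of the absolute values of the entries. Eve can ensure payoff $\ge v$ if she has a strategy $\tau$ such that $P(\sigma,\tau)\ge v$ for all strategies $\sigma$ of Adam. The maximal payoff that Eve can ensure is the supremum of all such $v$, that is, $\sup_\tau\inf_\sigma P(\sigma,\tau)$. The following problem is undecidable: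 given $M$, $N$ and (lists of the elements of) $\mathscr A$ and $\mathscr E$ as above, is the maximal payoff that Eve can ensure $<2$? -/

import Mathlib

open scoped ENNReal

namespace MMG

/-- A strategy of Adam: it maps a finite history `A₁E₁⋯AₖEₖ` to Adam's next matrix. -/
abbrev AdamStrategy {m n : ℕ} (𝒜 : Set (Matrix (Fin m) (Fin n) ℝ))
    (ℰ : Set (Matrix (Fin n) (Fin m) ℝ)) : Type :=
  List (𝒜 × ℰ) → 𝒜

/-- A strategy of Eve: it maps a finite history `A₁E₁⋯AₖEₖAₖ₊₁` to Eve's next matrix. -/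
abbrev EveStrategy {m n : ℕ} (𝒜 : Set (Matrix (Fin m) (Fin n) ℝ))
    (ℰ : Set (Matrix (Fin n) (Fin m) ℝ)) : Type :=
  List (𝒜 × ℰ) → 𝒜 → ℰ

/-- The history after `k` rounds, when Adam follows `σ` and Eve follows `τ`. -/
def history {m n : ℕ} {𝒜 : Set (Matrix (Fin m) (Fin n) ℝ)} {ℰ : Set (Matrix (Fin n) (Fin m) ℝ)}
    (σ : AdamStrategy 𝒜 ℰ) (τ : EveStrategy 𝒜 ℰ) : ℕ → List (𝒜 × ℰ)
  | 0 => []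
  | k + 1 => history σ τ k ++
      [(σ (history σ τ k), τ (history σ τ k) (σ (history σ τ k)))]

/-- The unique infinite play compatible with both `σ` and `τ`, as the sequence of its rounds
(numbered from `0`). -/
def play {m n : ℕ} {𝒜 : Set (Matrix (Fin m) (Fin n) ℝ)} {ℰ : Set (Matrix (Fin n) (Fin m) ℝ)}
    (σ : AdamStrategy 𝒜 ℰ) (τ : EveStrategy 𝒜 ℰ) (k : ℕ) : 𝒜 × ℰ :=
  (σ (history σ τ k), τ (history σ τ k) (σ (history σ τ k)))

/-- The product of the matrices written in the first `k` rounds, in the order of play. -/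
def partialProduct {m n : ℕ} {𝒜 : Set (Matrix (Fin m) (Fin n) ℝ)}
    {ℰ : Set (Matrix (Fin n) (Fin m) ℝ)} (π : ℕ → 𝒜 × ℰ) (k : ℕ) : Matrix (Fin m) (Fin m) ℝ :=
  ((List.range k).map fun i => (π i).1.1 * (π i).2.1).prod

/-- The `1`-norm of a matrix: the sum of the absolute values of its entries. -/
def oneNorm {m : ℕ} (B : Matrix (Fin m) (Fin m) ℝ) : ℝ :=
  ∑ i, ∑ j, |B i j|

/-- The payoff of a play: the limit superior of the `k`-th roots of the norms of the partial
products. -/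
noncomputable def payoff {m n : ℕ} {𝒜 : Set (Matrix (Fin m) (Fin n) ℝ)}
    {ℰ : Set (Matrix (Fin n) (Fin m) ℝ)} (π : ℕ → 𝒜 × ℰ) : ℝ≥0∞ :=
  Filter.limsup (fun k : ℕ => ENNReal.ofReal (oneNorm (partialProduct π k) ^ (1 / (k : ℝ)))) Filter.atTop

/-- Eve can ensure payoff at least `v`: some strategy of hers yields a payoff of at least `v`
against every strategy of Adam. -/
def EveEnsures {m n : ℕ} (𝒜 : Set (Matrix (Fin m) (Fin n) ℝ))
    (ℰ : Set (Matrix (Fin n) (Fin m) ℝ)) (v : ℝ≥0∞) : Prop :=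
  ∃ τ : EveStrategy 𝒜 ℰ, ∀ σ : AdamStrategy 𝒜 ℰ, v ≤ payoff (play σ τ)

/-- The maximal payoff (the supremum of the payoffs) that Eve can ensure. -/
noncomputable def eveValue {m n : ℕ} (𝒜 : Set (Matrix (Fin m) (Fin n) ℝ))
    (ℰ : Set (Matrix (Fin n) (Fin m) ℝ)) : ℝ≥0∞ :=
  sSup {v : ℝ≥0∞ | EveEnsures 𝒜 ℰ v}

/-- A matrix multiplication game given by nonempty finite sets of matrices with non-negative
integer entries. -/
structure NatGame where
  /-- The number of rows of Adam's matrices. -/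
  m : ℕ
  /-- The number of columns of Adam's matrices. -/
  n : ℕ
  m_pos : 0 < m
  n_pos : 0 < n
  adam : Finset (Matrix (Fin m) (Fin n) ℕ)
  eve : Finset (Matrix (Fin n) (Fin m) ℕ)
  adam_nonempty : adam.Nonempty
  eve_nonempty : eve.Nonempty

/-- Adam's set, as a set of real matrices. -/
def NatGame.adamSet (G : NatGame) : Set (Matrix (Fin G.m) (Fin G.n) ℝ) :=
  {A | ∃ B ∈ G.adam, A = B.map (fun a : ℕ => (a : ℝ))}

/-- Eve's set, as a set of real matrices. -/
def NatGame.eveSet (G : NatGame) : Set (Matrix (Fin G.n) (Fin G.m) ℝ) :=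
  {E | ∃ B ∈ G.eve, E = B.map (fun a : ℕ => (a : ℝ))}

/-- The maximal payoff that Eve can ensure in the game `G`. -/
noncomputable def NatGame.maxEvePayoff (G : NatGame) : ℝ≥0∞ :=
  eveValue G.adamSet G.eveSet

/-- A matrix written out as the list of its rows. -/
def matrixCode {m n : ℕ} (B : Matrix (Fin m) (Fin n) ℕ) : List (List ℕ) :=
  List.ofFn fun i => List.ofFn fun j => B i j

/-- Inputs of the decision problem: the two dimensions, a list of Adam's matrices and a list of
Eve's matrices, each matrix being a list of rows. -/
abbrev GameCode : Type :=
  ℕ × ℕ × List (List (List ℕ)) × List (List (List ℕ))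

/-- `c` is a description of the game `G`: it lists the matrices in the two sets (in any order,
repetitions being allowed). -/
def IsCodeOf (c : GameCode) (G : NatGame) : Prop :=
  ∃ (As : List (Matrix (Fin G.m) (Fin G.n) ℕ)) (Es : List (Matrix (Fin G.n) (Fin G.m) ℕ)),
    (∀ B, B ∈ As ↔ B ∈ G.adam) ∧ (∀ B, B ∈ Es ↔ B ∈ G.eve) ∧
      c = (G.m, G.n, As.map matrixCode, Es.map matrixCode)

end MMG

/-! The halting problem is reduced to the question, in two stages.

Counter systems. An alternating counter system resets, increments and copies registers; after each
operation Adam and then Eve influence the jump, and the only test is a single comparison that ends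
the run. This suffices to define halting. Adam's choices give disjunctions and existential guesses,
Eve's choices give conjunctions (she picks the claim to be checked), and a loop whose guessed values
Eve may challenge gives primitive recursion. This yields `DefFun.primrec` and, with a guessed step
bound, `exists_undecidable_system`.

Games. The row vector of a play is a multiple `c` of either a unit vector on a chain of `n + 1`
positions or a register vector holding 1, each content `x r` and each complement `w - 1 - x r`. The
chain takes `n + 1` rounds without growth and ends at scale `w = 2 ^ (n + 1)`, large enough for the
input; each operation doubles `w`, so `w` is 2 to the number of rounds of the current cycle. A final
comparison of `x r` with `x s` leads back to the chain and multiplies `c` by `2 * (x r + (w - 1 - x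
s))`. Growth by 2 per round over the cycle would be exactly `2 * w`: a failed comparison gives at
least that, a successful one at most `2 * (w - 1)`.

If Adam cannot force success, Eve keeps growth 2 per round, even when Adam never finishes a cycle or
restarts early (`two_le_eveValue`). If he can, he can do so within a bounded number of rounds
(`Prov.exists_provWithin`), so every cycle loses a uniform factor and the rate stays below some `2 *
δ < 2` (`eveValue_lt_two`). -/

namespace MMG

/-! ### Alternating counter systems -/

/-- Elementary operations on registers indexed by `V`. -/
inductive RegOp (V : Type) : Type
  | nop : RegOp V
  | zero (i : V) : RegOp V
  | inc (i : V) : RegOp V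
  | copy (i j : V) : RegOp V

/-- The effect of an operation on the register contents; `copy i j` sets register `i` to the
content of register `j`. -/
def RegOp.app {V : Type} [DecidableEq V] : RegOp V → (V → ℕ) → V → ℕ
  | nop, x => x
  | zero i, x => Function.update x i 0
  | inc i, x => Function.update x i (x i + 1)
  | copy i j, x => Function.update x i (x j)

/-- Renaming of the registers of an operation. -/
def RegOp.rename {V W : Type} (ι : V → W) : RegOp V → RegOp W
  | nop => nop
  | zero i => zero (ι i)
  | inc i => inc (ι i)
  | copy i j => copy (ι i) (ι j)

/-- Instructions of an alternating counter system with control states in `Q`: either a final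
comparison, or an operation followed by a jump chosen by Adam (first argument) and Eve (second
argument). -/
inductive Instr (V Q : Type) : Type
  | le (i j : V) : Instr V Q
  | step (op : RegOp V) (next : Bool → Bool → Q) : Instr V Q

/-- Renaming of registers and control states. -/
def Instr.rename {V W Q Q' : Type} (ι : V → W) (φ : Q → Q') : Instr V Q → Instr W Q'
  | le i j => le (ι i) (ι j)
  | step op next => step (op.rename ι) fun a e => φ (next a e)

/-- `Prov S q x`: in the system `S`, Adam can force a successful comparison from control state `q`
with register contents `x`. -/
inductive Prov {V Q : Type} [DecidableEq V] (S : Q → Instr V Q) : Q → (V → ℕ) → Prop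
  | le {q : Q} {x : V → ℕ} {i j : V} (h : S q = .le i j) (hx : x i ≤ x j) : Prov S q x
  | step {q : Q} {x : V → ℕ} {op : RegOp V} {next : Bool → Bool → Q} (h : S q = .step op next)
      (a : Bool) (hp : ∀ e, Prov S (next a e) (op.app x)) : Prov S q x

section Prov

variable {V W Q Q' : Type} [DecidableEq V] [DecidableEq W]

theorem prov_le_iff {S : Q → Instr V Q} {q : Q} {x : V → ℕ} {i j : V} (h : S q = .le i j) :
    Prov S q x ↔ x i ≤ x j := by
  refine ⟨fun hp => ?_, Prov.le h⟩
  cases hp with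
  | le h' hx => rw [h] at h'; cases h'; exact hx
  | step h' => rw [h] at h'; cases h'

theorem prov_step_iff {S : Q → Instr V Q} {q : Q} {x : V → ℕ} {op : RegOp V}
    {next : Bool → Bool → Q} (h : S q = .step op next) :
    Prov S q x ↔ ∃ a, ∀ e, Prov S (next a e) (op.app x) := by
  refine ⟨fun hp => ?_, fun ⟨a, ha⟩ => Prov.step h a ha⟩
  cases hp with
  | le h' => rw [h] at h'; cases h'
  | step h' a ha => rw [h] at h'; cases h'; exact ⟨a, ha⟩

theorem RegOp.app_rename_comp {ι : V → W} (hι : Function.Injective ι) (op : RegOp V) (x : W → ℕ) :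
    (op.rename ι).app x ∘ ι = op.app (x ∘ ι) := by
  cases op <;> simp [RegOp.rename, RegOp.app, Function.update_comp_eq_of_injective _ hι]

/-- The image of `φ` is closed under jumps, and restriction along `ι` commutes with the operations,
so a system keeps its meaning inside a larger one. Every gluing construction below rests on this. -/
theorem prov_rename_iff {ι : V → W} (hι : Function.Injective ι) {φ : Q → Q'}
    {S : Q → Instr V Q} {S' : Q' → Instr W Q'} (h : ∀ q, S' (φ q) = (S q).rename ι φ) (q : Q)
    (x : W → ℕ) : Prov S' (φ q) x ↔ Prov S q (x ∘ ι) := by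
  constructor
  · intro hp
    generalize hq : φ q = q' at hp
    induction hp generalizing q with
    | le h' hx =>
      subst hq
      rw [h] at h'
      cases hS : S q with
      | le i j =>
        rw [hS] at h'
        cases h'
        exact Prov.le hS hx
      | step op next => rw [hS] at h'; cases h'
    | step h' a _ ih =>
      subst hq
      rw [h] at h'
      cases hS : S q with
      | le i j => rw [hS] at h'; cases h'
      | step op next =>
        rw [hS] at h'
        cases h'
        refine Prov.step hS a fun e => ?_
        rw [← RegOp.app_rename_comp hι]
        exact ih e _ rfl
  · intro hp
    generalize hy : x ∘ ι = y at hp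
    induction hp generalizing x with
    | le h' hx => subst hy; exact Prov.le (by rw [h, h']; rfl) hx
    | step h' a _ ih =>
      subst hy
      exact Prov.step (by rw [h, h']; rfl) a fun e => ih e _ (RegOp.app_rename_comp hι _ _)

theorem prov_map_iff {φ : Q → Q'} {S : Q → Instr V Q} {S' : Q' → Instr V Q'}
    (h : ∀ q, S' (φ q) = (S q).rename id φ) (q : Q) (x : V → ℕ) :
    Prov S' (φ q) x ↔ Prov S q x :=
  prov_rename_iff Function.injective_id h q x

end Prov

/-! ### Relations definable by finite systems -/

/-- A relation on registers is definable if some finite system recognizes it. -/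
def Definable (ρ : (ℕ → ℕ) → Prop) : Prop :=
  ∃ (Q : Type) (_ : Finite Q) (S : Q → Instr ℕ Q) (q₀ : Q), ∀ x, Prov S q₀ x ↔ ρ x

namespace Definable

variable {ρ σ : (ℕ → ℕ) → Prop}

theorem congr (h : Definable ρ) (e : ∀ x, ρ x ↔ σ x) : Definable σ := by
  obtain ⟨Q, hQ, S, q, hS⟩ := h
  exact ⟨Q, hQ, S, q, fun x => (hS x).trans (e x)⟩

theorem le (i j : ℕ) : Definable fun x => x i ≤ x j :=
  ⟨Unit, inferInstance, fun _ => .le i j, (), fun _ => prov_le_iff rfl⟩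

/-- Combination of two systems by one new initial state. -/
theorem combine (hρ : Definable ρ) (hσ : Definable σ) (f : Bool → Bool → Bool) :
    Definable fun x => ∃ a, ∀ e, if f a e then ρ x else σ x := by
  obtain ⟨Q₁, hQ₁, S₁, q₁, h₁⟩ := hρ
  obtain ⟨Q₂, hQ₂, S₂, q₂, h₂⟩ := hσ
  let S : Option (Q₁ ⊕ Q₂) → Instr ℕ (Option (Q₁ ⊕ Q₂))
    | none => .step .nop fun a e => if f a e then some (.inl q₁) else some (.inr q₂)
    | some (.inl q) => (S₁ q).rename id fun q => some (.inl q)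
    | some (.inr q) => (S₂ q).rename id fun q => some (.inr q)
  refine ⟨_, inferInstance, S, none, fun x => ?_⟩
  have e₁ : Prov S (some (.inl q₁)) x ↔ Prov S₁ q₁ x :=
    prov_map_iff (S' := S) (φ := fun q => some (.inl q)) (fun _ => rfl) q₁ x
  have e₂ : Prov S (some (.inr q₂)) x ↔ Prov S₂ q₂ x :=
    prov_map_iff (S' := S) (φ := fun q => some (.inr q)) (fun _ => rfl) q₂ x
  rw [prov_step_iff (show S none = _ from rfl)]
  refine exists_congr fun a => forall_congr' fun e => ?_
  by_cases hf : f a e <;> simp [hf, RegOp.app, e₁, e₂, h₁, h₂]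

/-- The jump depends on Eve's bit alone, so Adam must be ready for both conjuncts; for disjunctions
it depends on Adam's bit alone. -/
theorem and (hρ : Definable ρ) (hσ : Definable σ) : Definable fun x => ρ x ∧ σ x :=
  (hρ.combine hσ fun _ e => e).congr fun x => by simp [and_comm]

theorem or (hρ : Definable ρ) (hσ : Definable σ) : Definable fun x => ρ x ∨ σ x :=
  (hρ.combine hσ fun a _ => a).congr fun x => by simp [or_comm]

theorem op (hρ : Definable ρ) (o : RegOp ℕ) : Definable fun x => ρ (o.app x) := by
  obtain ⟨Q, hQ, S, q, h⟩ := hρ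
  let S' : Option Q → Instr ℕ (Option Q)
    | none => .step o fun _ _ => some q
    | some q => (S q).rename id some
  refine ⟨_, inferInstance, S', none, fun x => ?_⟩
  rw [prov_step_iff (show S' none = _ from rfl)]
  simp [prov_map_iff (φ := some) (S' := S') (fun _ => rfl), h]

/-- Adam zeroes the register and increments it until he has his witness. Incrementing forever is no
success, because `Prov` is inductive. -/
theorem ex (hρ : Definable ρ) (i : ℕ) : Definable fun x => ∃ v, ρ (Function.update x i v) := by
  obtain ⟨Q, hQ, S, q₀, h⟩ := hρ
  let S' : Q ⊕ Bool → Instr ℕ (Q ⊕ Bool)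
    | .inl q => (S q).rename id .inl
    | .inr false => .step (.zero i) fun a _ => if a then .inl q₀ else .inr true
    | .inr true => .step (.inc i) fun a _ => if a then .inl q₀ else .inr true
  have hinl (q : Q) (x : ℕ → ℕ) : Prov S' (.inl q) x ↔ Prov S q x :=
    prov_map_iff (φ := .inl) (S' := S') (fun _ => rfl) q x
  have hsound : ∀ q x, Prov S' q x → q = .inr true → ∃ v, ρ (Function.update x i v) := by
    intro q x hp
    induction hp with
    | le h' => rintro rfl; cases h'
    | @step q x op next h' a hp ih =>
      rintro rfl
      cases h'
      cases a
      · obtain ⟨v, hv⟩ := ih true rfl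
        exact ⟨v, by simpa [RegOp.app] using hv⟩
      · exact ⟨x i + 1, (h _).1 ((hinl _ _).1 (hp true))⟩
  -- State `.inr true` increments before it can stop, hence the `+ 1`; the value 0 is handled by
  -- `.inr false`.
  have hcomplete : ∀ k x, ρ (Function.update x i (x i + k + 1)) → Prov S' (.inr true) x := by
    intro k
    induction k with
    | zero => exact fun x hx => Prov.step rfl true fun _ => (hinl _ _).2 ((h _).2 hx)
    | succ k ih =>
      refine fun x hx => Prov.step rfl false fun _ => ih _ ?_
      simpa [RegOp.app, add_assoc, add_comm, add_left_comm] using hx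
  refine ⟨_, inferInstance, S', .inr false, fun x => ?_⟩
  rw [prov_step_iff (show S' (.inr false) = _ from rfl)]
  constructor
  · rintro ⟨a, ha⟩
    cases a
    · obtain ⟨v, hv⟩ := hsound _ _ (ha true) rfl
      exact ⟨v, by simpa [RegOp.app] using hv⟩
    · exact ⟨0, (h _).1 ((hinl _ _).1 (ha true))⟩
  · rintro ⟨v, hv⟩
    cases v with
    | zero => exact ⟨true, fun _ => (hinl _ _).2 ((h _).2 hv)⟩
    | succ k => exact ⟨false, fun _ => hcomplete k _ (by simpa [RegOp.app] using hv)⟩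

end Definable

/-- The relation computed by a loop: the loop may be left when `β` holds; otherwise a value
satisfying `γ` is guessed in register `i` and copied to register `r`, register `k` is increased,
and the loop is entered again. -/
inductive LoopRel (β γ : (ℕ → ℕ) → Prop) (i r k : ℕ) : (ℕ → ℕ) → Prop
  | exit {x : ℕ → ℕ} (h : β x) : LoopRel β γ i r k x
  | again {x : ℕ → ℕ} (v : ℕ) (h : γ (Function.update x i v))
      (hl : LoopRel β γ i r k ((RegOp.inc k).app ((RegOp.copy r i).app (Function.update x i v)))) :
      LoopRel β γ i r k x

namespace Definable

/-- The auxiliary control states of a loop. -/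
inductive LoopState : Type
  | head | guess | more | verify | update | count

instance : Finite LoopState :=
  Finite.of_injective (β := Fin 6)
    (fun s => match s with
      | .head => 0 | .guess => 1 | .more => 2 | .verify => 3 | .update => 4 | .count => 5)
    (by intro s t; cases s <;> cases t <;> simp)

theorem loop {β γ : (ℕ → ℕ) → Prop} (hβ : Definable β) (hγ : Definable γ) (i r k : ℕ) :
    Definable (LoopRel β γ i r k) := by
  obtain ⟨Q₁, hQ₁, S₁, q₁, h₁⟩ := hβ
  obtain ⟨Q₂, hQ₂, S₂, q₂, h₂⟩ := hγ
  let S : (Q₁ ⊕ Q₂) ⊕ LoopState → Instr ℕ ((Q₁ ⊕ Q₂) ⊕ LoopState)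
    | .inl (.inl q) => (S₁ q).rename id fun q => .inl (.inl q)
    | .inl (.inr q) => (S₂ q).rename id fun q => .inl (.inr q)
    | .inr .head => .step .nop fun a _ => if a then .inl (.inl q₁) else .inr .guess
    | .inr .guess => .step (.zero i) fun a _ => if a then .inr .verify else .inr .more
    | .inr .more => .step (.inc i) fun a _ => if a then .inr .verify else .inr .more
    | .inr .verify => .step .nop fun _ e => if e then .inl (.inr q₂) else .inr .update
    | .inr .update => .step (.copy r i) fun _ _ => .inr .count
    | .inr .count => .step (.inc k) fun _ _ => .inr .head
  have e₁ (x : ℕ → ℕ) : Prov S (.inl (.inl q₁)) x ↔ β x :=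
    (prov_map_iff (S' := S) (φ := fun q => .inl (.inl q)) (fun _ => rfl) q₁ x).trans (h₁ x)
  have e₂ (x : ℕ → ℕ) : Prov S (.inl (.inr q₂)) x ↔ γ x :=
    (prov_map_iff (S' := S) (φ := fun q => .inl (.inr q)) (fun _ => rfl) q₂ x).trans (h₂ x)
  let L := LoopRel β γ i r k
  -- At `.verify` Eve either challenges the guess or lets the loop continue, so Adam needs both
  -- halves.
  let good : (ℕ → ℕ) → Prop := fun x => γ x ∧ L ((RegOp.inc k).app ((RegOp.copy r i).app x))
  let meaning : LoopState → (ℕ → ℕ) → Prop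
    | .head, x => L x
    | .guess, x => ∃ v, good (Function.update x i v)
    | .more, x => ∃ v, good (Function.update x i v)
    | .verify, x => good x
    | .update, x => L ((RegOp.inc k).app ((RegOp.copy r i).app x))
    | .count, x => L ((RegOp.inc k).app x)
  have hsound : ∀ q x, Prov S q x → ∀ s, q = .inr s → meaning s x := by
    intro q x hp
    induction hp with
    | le h' => rintro s rfl; cases s <;> cases h'
    | @step q x op next h' a hp ih =>
      rintro s rfl
      cases s
      · cases h'
        cases a
        · obtain ⟨v, hv, hl⟩ := ih true .guess rfl
          exact LoopRel.again v hv hl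
        · exact LoopRel.exit ((e₁ _).1 (hp true))
      · cases h'
        cases a
        · obtain ⟨v, hv⟩ := ih true .more rfl
          exact ⟨v, by simpa [RegOp.app] using hv⟩
        · exact ⟨0, ih true .verify rfl⟩
      · cases h'
        cases a
        · obtain ⟨v, hv⟩ := ih true .more rfl
          exact ⟨v, by simpa [RegOp.app] using hv⟩
        · exact ⟨_, ih true .verify rfl⟩
      · cases h'
        exact ⟨(e₂ _).1 (hp true), ih false .update rfl⟩
      · cases h'
        exact ih true .count rfl
      · cases h'
        exact ih true .head rfl
  have hmore : ∀ m x, Prov S (.inr .verify) (Function.update x i (x i + m + 1)) →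
      Prov S (.inr .more) x := by
    intro m
    induction m with
    | zero => exact fun x hx => Prov.step rfl true fun _ => hx
    | succ m ih =>
      refine fun x hx => Prov.step rfl false fun _ => ih _ ?_
      simpa [RegOp.app, add_assoc, add_comm, add_left_comm] using hx
  refine ⟨_, inferInstance, S, .inr .head, fun x => ⟨fun hp => hsound _ _ hp .head rfl, ?_⟩⟩
  intro hl
  induction hl with
  | exit h => exact Prov.step rfl true fun _ => (e₁ _).2 h
  | @again x v hv _ ih =>
    have hver : Prov S (.inr .verify) (Function.update x i v) := by
      refine Prov.step rfl true fun e => ?_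
      cases e
      · exact Prov.step rfl true fun _ => Prov.step rfl true fun _ => ih
      · exact (e₂ _).2 hv
    refine Prov.step rfl false fun _ => ?_
    cases v with
    | zero => exact Prov.step rfl true fun _ => hver
    | succ v =>
      refine Prov.step rfl false fun _ => hmore v _ ?_
      simpa [RegOp.app] using hver

end Definable

/-! ### Definable functions -/

/-- A function of the registers is definable if it depends on finitely many registers and all
equations between it and a register are definable. -/
def DefFun (g : (ℕ → ℕ) → ℕ) : Prop :=
  (∃ N, ∀ x y : ℕ → ℕ, (∀ i < N, x i = y i) → g x = g y) ∧ ∀ d, Definable fun x => x d = g x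

theorem Definable.eq (i j : ℕ) : Definable fun x => x i = x j :=
  ((Definable.le i j).and (Definable.le j i)).congr fun _ => le_antisymm_iff.symm

theorem DefFun.reg (i : ℕ) : DefFun fun x => x i :=
  ⟨⟨i + 1, fun _ _ h => h i i.lt_succ_self⟩, fun d => Definable.eq d i⟩

theorem DefFun.zero : DefFun fun _ => 0 := by
  refine ⟨⟨0, fun _ _ _ => rfl⟩, fun d => ?_⟩
  refine ((Definable.eq d (d + 1)).op (.zero (d + 1))).congr fun x => ?_
  simp [RegOp.app]

/-- Substitution of definable functions into a relation on registers. -/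
theorem Definable.subst {P : ℕ → ℕ → ℕ → ℕ → Prop}
    (hP : ∀ a b c d, Definable fun x => P (x a) (x b) (x c) (x d)) {g₁ g₂ g₃ g₄ : (ℕ → ℕ) → ℕ}
    (h₁ : DefFun g₁) (h₂ : DefFun g₂) (h₃ : DefFun g₃) (h₄ : DefFun g₄) :
    Definable fun x => P (g₁ x) (g₂ x) (g₃ x) (g₄ x) := by
  obtain ⟨⟨N₁, hN₁⟩, h₁⟩ := h₁
  obtain ⟨⟨N₂, hN₂⟩, h₂⟩ := h₂
  obtain ⟨⟨N₃, hN₃⟩, h₃⟩ := h₃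
  obtain ⟨⟨N₄, hN₄⟩, h₄⟩ := h₄
  -- None of the four functions reads a register from `t` on, so the values guessed there do not
  -- disturb them.
  let t := N₁ + N₂ + N₃ + N₄
  refine ((((((h₁ t).and (h₂ (t + 1))).and (h₃ (t + 2))).and (h₄ (t + 3))).and
    (hP t (t + 1) (t + 2) (t + 3))).ex (t + 3) |>.ex (t + 2) |>.ex (t + 1) |>.ex t).congr
    fun x => ?_
  have key (u v w z : ℕ) (i : ℕ) (hi : i < t) :
      Function.update (Function.update (Function.update (Function.update x t u) (t + 1) v)
        (t + 2) w) (t + 3) z i = x i := by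
    rw [Function.update_of_ne (by omega), Function.update_of_ne (by omega),
      Function.update_of_ne (by omega), Function.update_of_ne (by omega)]
  have key₁ (u v w z : ℕ) := hN₁ _ x fun i hi => key u v w z i (by omega)
  have key₂ (u v w z : ℕ) := hN₂ _ x fun i hi => key u v w z i (by omega)
  have key₃ (u v w z : ℕ) := hN₃ _ x fun i hi => key u v w z i (by omega)
  have key₄ (u v w z : ℕ) := hN₄ _ x fun i hi => key u v w z i (by omega)
  simp only [key₁, key₂, key₃, key₄]
  simp

theorem DefFun.of_regs {f : ℕ → ℕ → ℕ → ℕ}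
    (hf : ∀ a b c d, Definable fun x => x d = f (x a) (x b) (x c)) {g₁ g₂ g₃ : (ℕ → ℕ) → ℕ}
    (h₁ : DefFun g₁) (h₂ : DefFun g₂) (h₃ : DefFun g₃) :
    DefFun fun x => f (g₁ x) (g₂ x) (g₃ x) := by
  have ⟨⟨N₁, hN₁⟩, _⟩ := h₁
  have ⟨⟨N₂, hN₂⟩, _⟩ := h₂
  have ⟨⟨N₃, hN₃⟩, _⟩ := h₃
  refine ⟨⟨N₁ + N₂ + N₃, fun x y h => ?_⟩, fun d => ?_⟩
  · simp only
    rw [hN₁ x y fun i hi => h i (by omega), hN₂ x y fun i hi => h i (by omega),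
      hN₃ x y fun i hi => h i (by omega)]
  · exact Definable.subst (P := fun u v w z => z = f u v w) hf h₁ h₂ h₃ (DefFun.reg d)

theorem DefFun.of_regs₂ {f : ℕ → ℕ → ℕ}
    (hf : ∀ a b d, Definable fun x => x d = f (x a) (x b)) {g₁ g₂ : (ℕ → ℕ) → ℕ}
    (h₁ : DefFun g₁) (h₂ : DefFun g₂) : DefFun fun x => f (g₁ x) (g₂ x) :=
  DefFun.of_regs (f := fun u v _ => f u v) (fun a b _ d => hf a b d) h₁ h₂ h₂

theorem DefFun.of_regs₁ {f : ℕ → ℕ} (hf : ∀ a d, Definable fun x => x d = f (x a))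
    {g : (ℕ → ℕ) → ℕ} (h : DefFun g) : DefFun fun x => f (g x) :=
  DefFun.of_regs₂ (f := fun u _ => f u) (fun a _ d => hf a d) h h

theorem Definable.le_fun {g₁ g₂ : (ℕ → ℕ) → ℕ} (h₁ : DefFun g₁) (h₂ : DefFun g₂) :
    Definable fun x => g₁ x ≤ g₂ x :=
  Definable.subst (P := fun u v _ _ => u ≤ v) (fun a b _ _ => Definable.le a b) h₁ h₂ h₂ h₂

theorem Definable.eq_fun {g₁ g₂ : (ℕ → ℕ) → ℕ} (h₁ : DefFun g₁) (h₂ : DefFun g₂) :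
    Definable fun x => g₁ x = g₂ x :=
  Definable.subst (P := fun u v _ _ => u = v) (fun a b _ _ => Definable.eq a b) h₁ h₂ h₂ h₂

theorem DefFun.succ {g : (ℕ → ℕ) → ℕ} (h : DefFun g) : DefFun fun x => g x + 1 := by
  refine DefFun.of_regs₁ (f := fun u => u + 1) (fun a d => ?_) h
  -- The outermost operation runs first: copy to a scratch register, increment, compare.
  refine (((Definable.eq d (a + d + 1)).op (.inc (a + d + 1))).op (.copy (a + d + 1) a)).congr
    fun x => ?_
  have h₁ : d ≠ a + d + 1 := by omega
  simp [RegOp.app, h₁]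

theorem Definable.lt_fun {g₁ g₂ : (ℕ → ℕ) → ℕ} (h₁ : DefFun g₁) (h₂ : DefFun g₂) :
    Definable fun x => g₁ x < g₂ x :=
  Definable.le_fun h₁.succ h₂

/-- Definable functions are closed under primitive recursion. -/
theorem DefFun.recursion {h : ℕ → ℕ → ℕ → ℕ}
    (hh : ∀ a b c d, Definable fun x => x d = h (x a) (x b) (x c)) {g₁ g₂ g₃ : (ℕ → ℕ) → ℕ}
    (h₁ : DefFun g₁) (h₂ : DefFun g₂) (h₃ : DefFun g₃) :
    DefFun fun x => Nat.rec (motive := fun _ => ℕ) (g₃ x) (h (g₁ x)) (g₂ x) := by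
  refine DefFun.of_regs (f := fun z n b => Nat.rec (motive := fun _ => ℕ) b (h z) n)
    (fun a b c d => ?_) h₁ h₂ h₃
  -- Fresh registers: `k` is the loop counter, `k + 1` the accumulator, `k + 2` the guessed next
  -- value. The loop is left when the counter equals register `b` and the accumulator equals
  -- register `d`.
  obtain ⟨k, hk⟩ : ∃ k, k = a + b + c + d + 1 := ⟨_, rfl⟩
  have hka : a ≠ k ∧ a ≠ k + 1 ∧ a ≠ k + 2 := by omega
  have hkb : b ≠ k ∧ b ≠ k + 1 ∧ b ≠ k + 2 := by omega
  have hkc : c ≠ k ∧ c ≠ k + 1 ∧ c ≠ k + 2 := by omega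
  have hkd : d ≠ k ∧ d ≠ k + 1 ∧ d ≠ k + 2 := by omega
  have hL := ((Definable.eq k b).and (Definable.eq (k + 1) d)).loop (hh a k (k + 1) (k + 2))
    (k + 2) (k + 1) k
  refine ((hL.op (.copy (k + 1) c)).op (.zero k)).congr fun x => ?_
  have sound : ∀ y, LoopRel (fun x => x k = x b ∧ x (k + 1) = x d)
      (fun x => x (k + 2) = h (x a) (x k) (x (k + 1))) (k + 2) (k + 1) k y →
      ∀ u, y (k + 1) = Nat.rec (motive := fun _ => ℕ) u (h (y a)) (y k) →
        y d = Nat.rec (motive := fun _ => ℕ) u (h (y a)) (y b) := by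
    intro y hy
    induction hy with
    | exit hβ => intro u hu; rw [← hβ.1, ← hβ.2]; exact hu
    | @again y v hγ _ ih =>
      intro u hu
      have := ih u
      simp [RegOp.app, hka, hkb, hkd] at this hγ
      exact this (by rw [hγ, hu])
  -- `m` is the number of iterations left.
  have complete : ∀ m y u, y b = y k + m →
      y (k + 1) = Nat.rec (motive := fun _ => ℕ) u (h (y a)) (y k) →
      y d = Nat.rec (motive := fun _ => ℕ) u (h (y a)) (y b) →
      LoopRel (fun x => x k = x b ∧ x (k + 1) = x d)
        (fun x => x (k + 2) = h (x a) (x k) (x (k + 1))) (k + 2) (k + 1) k y := by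
    intro m
    induction m with
    | zero =>
      intro y u hm hu hd
      exact .exit ⟨by omega, by rw [hu, hd, hm, add_zero]⟩
    | succ m ih =>
      intro y u hm hu hd
      refine .again (h (y a) (y k) (y (k + 1))) (by simp [hka]) (ih _ u ?_ ?_ ?_)
      · simp [RegOp.app, hkb]; omega
      · simp [RegOp.app, hka, hu]
      · simpa [RegOp.app, hka, hkb, hkd] using hd
  constructor
  · intro hl
    have := sound _ hl (x c) (by simp [RegOp.app, hkc])
    simpa [RegOp.app, hka, hkb, hkd] using this
  · intro hd
    refine complete (x b) _ (x c) ?_ ?_ ?_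
    · simp [RegOp.app, hkb]
    · simp [RegOp.app, hkc]
    · simpa [RegOp.app, hka, hkb, hkd] using hd

/-! ### Arithmetic, pairing and primitive recursive functions -/

theorem DefFun.add {g₁ g₂ : (ℕ → ℕ) → ℕ} (h₁ : DefFun g₁) (h₂ : DefFun g₂) :
    DefFun fun x => g₁ x + g₂ x := by
  have := DefFun.recursion (h := fun _ _ r => r + 1)
    (fun _ _ c d => Definable.eq_fun (DefFun.reg d) (DefFun.reg c).succ) h₁ h₂ h₁
  convert this using 2 with x
  induction g₂ x with
  | zero => rfl
  | succ n ih => rw [← add_assoc, ih]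

theorem DefFun.mul {g₁ g₂ : (ℕ → ℕ) → ℕ} (h₁ : DefFun g₁) (h₂ : DefFun g₂) :
    DefFun fun x => g₁ x * g₂ x := by
  have := DefFun.recursion (h := fun z _ r => r + z)
    (fun a _ c d => Definable.eq_fun (DefFun.reg d) ((DefFun.reg c).add (DefFun.reg a)))
    h₁ h₂ DefFun.zero
  convert this using 2 with x
  induction g₂ x with
  | zero => rfl
  | succ n ih => rw [Nat.mul_succ, ih]

theorem DefFun.pair {g₁ g₂ : (ℕ → ℕ) → ℕ} (h₁ : DefFun g₁) (h₂ : DefFun g₂) :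
    DefFun fun x => Nat.pair (g₁ x) (g₂ x) := by
  refine DefFun.of_regs₂ (f := Nat.pair) (fun a b d => ?_) h₁ h₂
  have ha := DefFun.reg a
  have hb := DefFun.reg b
  have hd := DefFun.reg d
  refine (((Definable.lt_fun ha hb).and (Definable.eq_fun hd ((hb.mul hb).add ha))).or
    ((Definable.le_fun hb ha).and (Definable.eq_fun hd (((ha.mul ha).add ha).add hb)))).congr
    fun x => ?_
  rw [Nat.pair]
  split_ifs with hlt <;> omega

/-- The inverse of pairing needs no computation: guess the other component and check the pair. -/
theorem DefFun.unpair_fst {g : (ℕ → ℕ) → ℕ} (hg : DefFun g) :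
    DefFun fun x => (g x).unpair.1 := by
  have aux (a d : ℕ) : d ≠ a + d + 1 ∧ a ≠ a + d + 1 := by omega
  refine DefFun.of_regs₁ (f := fun n => n.unpair.1) (fun a d => ?_) hg
  refine ((Definable.eq_fun (DefFun.reg a)
    ((DefFun.reg d).pair (DefFun.reg (a + d + 1)))).ex (a + d + 1)).congr fun x => ?_
  simp only [Function.update_self, Function.update_of_ne (aux a d).1,
    Function.update_of_ne (aux a d).2]
  exact ⟨fun ⟨v, hv⟩ => by rw [hv, Nat.unpair_pair], fun h => ⟨(x a).unpair.2, by simp [h]⟩⟩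

theorem DefFun.unpair_snd {g : (ℕ → ℕ) → ℕ} (hg : DefFun g) :
    DefFun fun x => (g x).unpair.2 := by
  have aux (a d : ℕ) : d ≠ a + d + 1 ∧ a ≠ a + d + 1 := by omega
  refine DefFun.of_regs₁ (f := fun n => n.unpair.2) (fun a d => ?_) hg
  refine ((Definable.eq_fun (DefFun.reg a)
    ((DefFun.reg (a + d + 1)).pair (DefFun.reg d))).ex (a + d + 1)).congr fun x => ?_
  simp only [Function.update_self, Function.update_of_ne (aux a d).1,
    Function.update_of_ne (aux a d).2]
  exact ⟨fun ⟨v, hv⟩ => by rw [hv, Nat.unpair_pair], fun h => ⟨(x a).unpair.1, by simp [h]⟩⟩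

/-- Primitive recursive functions are definable. -/
theorem DefFun.primrec {f : ℕ → ℕ} (hf : Nat.Primrec f) {g : (ℕ → ℕ) → ℕ} (hg : DefFun g) :
    DefFun fun x => f (g x) := by
  induction hf generalizing g with
  | zero => exact DefFun.zero
  | succ => exact hg.succ
  | left => exact hg.unpair_fst
  | right => exact hg.unpair_snd
  | pair _ _ ih₁ ih₂ => exact (ih₁ hg).pair (ih₂ hg)
  | comp _ _ ih₁ ih₂ => exact ih₁ (ih₂ hg)
  | @prec f g' _ _ ih₁ ih₂ =>
    exact DefFun.recursion (h := fun z y r => g' (Nat.pair z (Nat.pair y r)))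
      (fun a b c d => Definable.eq_fun (DefFun.reg d)
        (ih₂ ((DefFun.reg a).pair ((DefFun.reg b).pair (DefFun.reg c))))) hg.unpair_fst hg.unpair_snd
      (ih₁ hg.unpair_fst)

/-! ### Undecidability of counter systems -/

theorem computablePred_comp {α β : Type} [Primcodable α] [Primcodable β] {p : β → Prop}
    (hp : ComputablePred p) {f : α → β} (hf : Computable f) : ComputablePred fun a => p (f a) :=
  ComputablePred.computable_of_manyOneReducible ⟨f, hf, fun _ => Iff.rfl⟩ hp

/-- The halting problem is defined by a finite alternating counter system. -/
theorem exists_undecidable_system : ∃ (Q : Type) (_ : Finite Q) (S : Q → Instr ℕ Q) (q₀ : Q),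
    ¬ ComputablePred fun n : ℕ => Prov S q₀ (fun i => if i = 0 then n else 0) := by
  -- `none` is encoded by 0, so a positive value says that the code halts on input 0 within the
  -- given bound.
  let F : ℕ → ℕ := fun p =>
    Encodable.encode (Nat.Partrec.Code.evaln p.unpair.1 (Denumerable.ofNat _ p.unpair.2) 0)
  have hF : Nat.Primrec F := by
    refine Primrec.nat_iff.1 (Primrec.encode.comp (Nat.Partrec.Code.primrec_evaln.comp
      (((Primrec.fst.comp Primrec.unpair).pair
        ((Primrec.ofNat _).comp (Primrec.snd.comp Primrec.unpair))).pair (Primrec.const 0))))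
  have hdef : Definable fun x => ∃ v, 0 < F (Nat.pair v (x 0)) := by
    refine ((Definable.lt_fun DefFun.zero
      (DefFun.primrec hF ((DefFun.reg 1).pair (DefFun.reg 0)))).ex 1).congr fun x => ?_
    simp
  obtain ⟨Q, hQ, S, q, h⟩ := hdef
  refine ⟨Q, hQ, S, q, fun hc => ComputablePred.halting_problem 0 ?_⟩
  refine (computablePred_comp hc
    (Computable.encode (α := Nat.Partrec.Code))).of_eq fun c => ?_
  rw [h]
  simp only [F, if_true, Nat.unpair_pair, Denumerable.ofNat_encode]
  rw [Part.dom_iff_mem]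
  simp only [Nat.Partrec.Code.evaln_complete]
  constructor
  · rintro ⟨v, hv⟩
    cases he : Nat.Partrec.Code.evaln v c 0 with
    | none => simp [he] at hv
    | some y => exact ⟨y, v, he⟩
  · rintro ⟨y, v, hv⟩
    refine ⟨v, ?_⟩
    rw [Option.mem_def] at hv
    simp [hv]

/-! ### Finitely many registers and bounded game length -/

theorem RegOp.exists_rename_val (o : RegOp ℕ) :
    ∃ N, ∀ R ≥ N, ∃ o' : RegOp (Fin (R + 1)), o'.rename Fin.val = o := by
  cases o with
  | nop => exact ⟨0, fun R _ => ⟨.nop, rfl⟩⟩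
  | zero i => exact ⟨i, fun R hR => ⟨.zero ⟨i, by omega⟩, rfl⟩⟩
  | inc i => exact ⟨i, fun R hR => ⟨.inc ⟨i, by omega⟩, rfl⟩⟩
  | copy i j => exact ⟨i + j, fun R hR => ⟨.copy ⟨i, by omega⟩ ⟨j, by omega⟩, rfl⟩⟩

theorem Instr.exists_rename_val {Q : Type} (I : Instr ℕ Q) :
    ∃ N, ∀ R ≥ N, ∃ I' : Instr (Fin (R + 1)) Q, I'.rename Fin.val id = I := by
  cases I with
  | le i j => exact ⟨i + j, fun R hR => ⟨.le ⟨i, by omega⟩ ⟨j, by omega⟩, rfl⟩⟩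
  | step o next =>
    obtain ⟨N, hN⟩ := o.exists_rename_val
    refine ⟨N, fun R hR => ?_⟩
    obtain ⟨o', ho⟩ := hN R hR
    exact ⟨.step o' next, by simp [Instr.rename, ho]⟩

/-- A finite system mentions finitely many registers. The size `R + 1` provides register 0 for the
input and makes the register set nonempty, as the norm estimates require. -/
theorem exists_undecidable_finite_system : ∃ (R : ℕ) (Q : Type) (_ : Finite Q)
    (S : Q → Instr (Fin (R + 1)) Q) (q₀ : Q),
    ¬ ComputablePred fun n : ℕ => Prov S q₀ (fun i => if i = 0 then n else 0) := by
  obtain ⟨Q, hQ, S, q₀, h⟩ := exists_undecidable_system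
  choose N hN using fun q => (S q).exists_rename_val
  have := Fintype.ofFinite Q
  choose S' hS' using fun q => hN q (Finset.univ.sup N) (Finset.le_sup (Finset.mem_univ q))
  refine ⟨_, Q, hQ, S', q₀, fun hc => h (hc.of_eq fun n => ?_)⟩
  have := prov_rename_iff (φ := id) (S := S') (S' := S) Fin.val_injective
    (fun q => (hS' q).symm) q₀ (fun i => if i = 0 then n else 0)
  refine Iff.trans (iff_of_eq ?_) this.symm
  congr 1
  funext i
  simp only [Function.comp_apply, Fin.ext_iff, Fin.val_zero]

/-- Adam can force a successful comparison within `k` rounds. -/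
def ProvWithin {V Q : Type} [DecidableEq V] (S : Q → Instr V Q) : ℕ → Q → (V → ℕ) → Prop
  | 0, _, _ => False
  | k + 1, q, x => match S q with
    | .le i j => x i ≤ x j
    | .step op next => ∃ a, ∀ e, ProvWithin S k (next a e) (op.app x)

section ProvWithin

variable {V Q : Type} [DecidableEq V] {S : Q → Instr V Q}

theorem provWithin_succ_le {k : ℕ} {q : Q} {x : V → ℕ} {i j : V} (h : S q = .le i j) :
    ProvWithin S (k + 1) q x ↔ x i ≤ x j := by
  rw [ProvWithin, h]

theorem provWithin_succ_step {k : ℕ} {q : Q} {x : V → ℕ} {op : RegOp V}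
    {next : Bool → Bool → Q} (h : S q = .step op next) :
    ProvWithin S (k + 1) q x ↔ ∃ a, ∀ e, ProvWithin S k (next a e) (op.app x) := by
  rw [ProvWithin, h]

theorem ProvWithin.mono {k l : ℕ} (hkl : k ≤ l) {q : Q} {x : V → ℕ} (h : ProvWithin S k q x) :
    ProvWithin S l q x := by
  induction k generalizing l q x with
  | zero => exact h.elim
  | succ k ih =>
    obtain ⟨l, rfl⟩ : ∃ m, l = m + 1 := ⟨l - 1, by omega⟩
    cases hS : S q with
    | le i j => rwa [provWithin_succ_le hS] at h ⊢
    | step op next =>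
      rw [provWithin_succ_step hS] at h ⊢
      obtain ⟨a, ha⟩ := h
      exact ⟨a, fun e => ih (by omega) (ha e)⟩

/-- Eve has only two replies, so the bounds for both subtrees combine into one that is uniform over
her play. -/
theorem Prov.exists_provWithin {q : Q} {x : V → ℕ} (h : Prov S q x) :
    ∃ k, ProvWithin S k q x := by
  induction h with
  | le h hx => exact ⟨1, (provWithin_succ_le h).2 hx⟩
  | step h a _ ih =>
    choose k hk using ih
    exact ⟨k true + k false + 1, (provWithin_succ_step h).2
      ⟨a, fun e => (hk e).mono (by cases e <;> omega)⟩⟩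

end ProvWithin

end MMG

namespace MMG

/-! ### Strategies given by invariants -/

open Matrix

section Strategies

variable {m n : ℕ} {𝒜 : Set (Matrix (Fin m) (Fin n) ℝ)} {ℰ : Set (Matrix (Fin n) (Fin m) ℝ)}

theorem history_eq_map (σ : AdamStrategy 𝒜 ℰ) (τ : EveStrategy 𝒜 ℰ) (k : ℕ) :
    history σ τ k = (List.range k).map (play σ τ) := by
  induction k with
  | zero => rfl
  | succ k ih => rw [List.range_succ, List.map_append, ← ih]; rfl

theorem partialProduct_succ (π : ℕ → 𝒜 × ℰ) (k : ℕ) :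
    partialProduct π (k + 1) = partialProduct π k * ((π k).1.1 * (π k).2.1) := by
  simp [partialProduct, List.range_succ]

/-- The row vector obtained from `u` after a finite history. -/
noncomputable def rowAfter (u : Fin m → ℝ) (h : List (𝒜 × ℰ)) : Fin m → ℝ :=
  u ᵥ* (h.map fun p => p.1.1 * p.2.1).prod

theorem rowAfter_history (u : Fin m → ℝ) (σ : AdamStrategy 𝒜 ℰ) (τ : EveStrategy 𝒜 ℰ) (k : ℕ) :
    rowAfter u (history σ τ k) = u ᵥ* partialProduct (play σ τ) k := by
  rw [rowAfter, history_eq_map, List.map_map]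
  rfl

/-- The current row vector is a function of the history, so Eve can pick a reply preserving the
invariant; histories violating it get an arbitrary reply. -/
theorem exists_eveStrategy (hℰ : ℰ.Nonempty) {Inv : ℕ → (Fin m → ℝ) → Prop} {u : Fin m → ℝ}
    (h0 : Inv 0 u)
    (hstep : ∀ k y, Inv k y → ∀ A ∈ 𝒜, ∃ E ∈ ℰ, Inv (k + 1) (y ᵥ* A ᵥ* E)) :
    ∃ τ : EveStrategy 𝒜 ℰ, ∀ (σ : AdamStrategy 𝒜 ℰ) (k : ℕ),
      Inv k (u ᵥ* partialProduct (play σ τ) k) := by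
  classical
  have hex : ∀ (h : List (𝒜 × ℰ)) (A : 𝒜), ∃ E : ℰ, Inv h.length (rowAfter u h) →
      Inv (h.length + 1) (rowAfter u h ᵥ* A.1 ᵥ* E.1) := by
    intro h A
    by_cases hi : Inv h.length (rowAfter u h)
    · obtain ⟨E, hE, hI⟩ := hstep _ _ hi A.1 A.2
      exact ⟨⟨E, hE⟩, fun _ => hI⟩
    · exact ⟨⟨_, hℰ.some_mem⟩, fun h => (hi h).elim⟩
  choose τ hτ using hex
  refine ⟨τ, fun σ k => ?_⟩
  induction k with
  | zero => simpa [partialProduct] using h0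
  | succ k ih =>
    rw [← rowAfter_history] at ih
    have hlen : (history σ τ k).length = k := by simp [history_eq_map]
    have := hτ (history σ τ k) (σ (history σ τ k)) (by rwa [hlen])
    rw [hlen, rowAfter_history, vecMul_vecMul, vecMul_vecMul] at this
    rwa [partialProduct_succ]

theorem exists_adamStrategy (h𝒜 : 𝒜.Nonempty) {Inv : ℕ → (Fin m → ℝ) → Prop} {u : Fin m → ℝ}
    (h0 : Inv 0 u)
    (hstep : ∀ k y, Inv k y → ∃ A ∈ 𝒜, ∀ E ∈ ℰ, Inv (k + 1) (y ᵥ* A ᵥ* E)) :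
    ∃ σ : AdamStrategy 𝒜 ℰ, ∀ (τ : EveStrategy 𝒜 ℰ) (k : ℕ),
      Inv k (u ᵥ* partialProduct (play σ τ) k) := by
  classical
  have hex : ∀ h : List (𝒜 × ℰ), ∃ A : 𝒜, Inv h.length (rowAfter u h) →
      ∀ E ∈ ℰ, Inv (h.length + 1) (rowAfter u h ᵥ* A.1 ᵥ* E) := by
    intro h
    by_cases hi : Inv h.length (rowAfter u h)
    · obtain ⟨A, hA, hI⟩ := hstep _ _ hi
      exact ⟨⟨A, hA⟩, fun _ => hI⟩
    · exact ⟨⟨_, h𝒜.some_mem⟩, fun h => (hi h).elim⟩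
  choose σ hσ using hex
  refine ⟨σ, fun τ k => ?_⟩
  induction k with
  | zero => simpa [partialProduct] using h0
  | succ k ih =>
    rw [← rowAfter_history] at ih
    have hlen : (history σ τ k).length = k := by simp [history_eq_map]
    have := hσ (history σ τ k) (by rwa [hlen]) _ (τ (history σ τ k) (σ (history σ τ k))).2
    rw [hlen, rowAfter_history, vecMul_vecMul, vecMul_vecMul] at this
    rwa [partialProduct_succ]

/-! ### Bounds for the payoff -/

theorem oneNorm_nonneg (B : Matrix (Fin m) (Fin m) ℝ) : 0 ≤ oneNorm B :=
  Finset.sum_nonneg fun _ _ => Finset.sum_nonneg fun _ _ => abs_nonneg _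

theorem tendsto_root_geometric {C r : ℝ} (hC : 0 < C) (hr : 0 < r) :
    Filter.Tendsto (fun k : ℕ => ENNReal.ofReal ((C * r ^ k) ^ (1 / (k : ℝ)))) Filter.atTop
      (nhds (ENNReal.ofReal r)) := by
  refine ENNReal.tendsto_ofReal ?_
  have h1 : Filter.Tendsto (fun k : ℕ => C ^ (1 / (k : ℝ)) * r) Filter.atTop
      (nhds (C ^ (0 : ℝ) * r)) :=
    (((Real.continuousAt_const_rpow hC.ne').tendsto.comp
      tendsto_one_div_atTop_nhds_zero_nat)).mul_const r
  rw [Real.rpow_zero, one_mul] at h1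
  refine h1.congr' ?_
  filter_upwards [Filter.eventually_ne_atTop 0] with k hk
  rw [Real.mul_rpow hC.le (by positivity), one_div, Real.pow_rpow_inv_natCast hr.le hk]

theorem le_payoff {π : ℕ → 𝒜 × ℰ} {C r : ℝ} (hC : 0 < C) (hr : 0 < r)
    (h : ∀ k, C * r ^ k ≤ oneNorm (partialProduct π k)) : ENNReal.ofReal r ≤ payoff π := by
  rw [← (tendsto_root_geometric hC hr).limsup_eq]
  refine Filter.limsup_le_limsup (Filter.Eventually.of_forall fun k => ?_)
  exact ENNReal.ofReal_le_ofReal (Real.rpow_le_rpow (by positivity) (h k) (by positivity))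

theorem payoff_le {π : ℕ → 𝒜 × ℰ} {C r : ℝ} (hC : 0 < C) (hr : 0 < r)
    (h : ∀ k, oneNorm (partialProduct π k) ≤ C * r ^ k) : payoff π ≤ ENNReal.ofReal r := by
  rw [← (tendsto_root_geometric hC hr).limsup_eq]
  refine Filter.limsup_le_limsup (Filter.Eventually.of_forall fun k => ?_)
  exact ENNReal.ofReal_le_ofReal (Real.rpow_le_rpow (oneNorm_nonneg _) (h k) (by positivity))

/-- One row suffices for a lower bound on the norm; the upper bound below has to follow the all-ones
vector. -/
theorem sum_vecMul_single_le_oneNorm (s : Fin m) (B : Matrix (Fin m) (Fin m) ℝ) :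
    ∑ j, (Pi.single s 1 ᵥ* B) j ≤ oneNorm B := by
  rw [single_one_vecMul]
  refine (Finset.sum_le_sum fun j _ => le_abs_self _).trans ?_
  exact Finset.single_le_sum (f := fun i => ∑ j, |B i j|)
    (fun i _ => Finset.sum_nonneg fun _ _ => abs_nonneg _) (Finset.mem_univ s)

theorem oneNorm_eq_sum_vecMul_one {B : Matrix (Fin m) (Fin m) ℝ} (hB : ∀ i j, 0 ≤ B i j) :
    oneNorm B = ∑ j, (1 ᵥ* B) j := by
  simp only [oneNorm, vecMul, dotProduct, Pi.one_apply, one_mul]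
  rw [Finset.sum_comm]
  exact Finset.sum_congr rfl fun j _ => Finset.sum_congr rfl fun i _ => abs_of_nonneg (hB i j)

theorem partialProduct_nonneg (h𝒜 : ∀ A ∈ 𝒜, ∀ i j, 0 ≤ A i j) (hℰ : ∀ E ∈ ℰ, ∀ i j, 0 ≤ E i j)
    (π : ℕ → 𝒜 × ℰ) (k : ℕ) (i j : Fin m) : 0 ≤ partialProduct π k i j := by
  induction k generalizing i j with
  | zero =>
    simp only [partialProduct, List.range_zero, List.map_nil, List.prod_nil, one_apply]
    split_ifs <;> norm_num
  | succ k ih =>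
    rw [partialProduct_succ, mul_apply]
    refine Finset.sum_nonneg fun l _ => mul_nonneg (ih i l) ?_
    rw [mul_apply]
    exact Finset.sum_nonneg fun s _ => mul_nonneg (h𝒜 _ (π k).1.2 _ _) (hℰ _ (π k).2.2 _ _)

end Strategies

end MMG

namespace MMG

/-! ### The game of an alternating counter system -/

section Game

set_option linter.unusedSectionVars false

variable {V Q : Type} [Fintype V] [DecidableEq V] [Fintype Q] [DecidableEq Q]

/-- Coordinates of a register vector: a constant, and for each register its content
(with `false`) and its complement (with `true`). -/
abbrev Coord (V : Type) : Type := Option (V × Bool)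

/-- The coordinates of the game vectors: a control state, possibly with a pending choice of Adam,
together with a register coordinate; or a position of the start-up chain. -/
abbrev GameIndex (Q V : Type) (n : ℕ) : Type := (Q × Option Bool) × Coord V ⊕ Fin (n + 1)

/-- The register vector of the register contents `x` at scale `w`. -/
def regVec (x : V → ℕ) (w : ℝ) : Coord V → ℝ
  | none => 1
  | some (r, false) => x r
  | some (r, true) => w - 1 - x r

/-- The indicator function of a coordinate. -/
def coordUnit (κ κ' : Coord V) : ℕ := if κ' = κ then 1 else 0

/-- The transformation of register vectors for an operation and a doubling of the scale:
`opMat op κ' κ` is the contribution of coordinate `κ'` to the new coordinate `κ`. -/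
def opMat (op : RegOp V) (κ' : Coord V) : Coord V → ℕ
  | none => coordUnit none κ'
  | some (r, false) => match op with
    | .nop => coordUnit (some (r, false)) κ'
    | .zero i => if r = i then 0 else coordUnit (some (r, false)) κ'
    | .inc i => coordUnit (some (r, false)) κ' + if r = i then coordUnit none κ' else 0
    | .copy i j => coordUnit (some (if r = i then j else r, false)) κ'
  -- The basic identity is `2 * (w - 1 - x) + x + 1 = 2 * w - 1 - x`. Incrementing drops the 1 and
  -- zeroing adds another `x`, so doubling the scale keeps all coefficients non-negative.
  | some (r, true) => match op with
    | .nop =>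
      2 * coordUnit (some (r, true)) κ' + coordUnit (some (r, false)) κ' + coordUnit none κ'
    | .zero i => 2 * coordUnit (some (r, true)) κ' + coordUnit (some (r, false)) κ' +
        coordUnit none κ' + if r = i then coordUnit (some (r, false)) κ' else 0
    | .inc i => 2 * coordUnit (some (r, true)) κ' + coordUnit (some (r, false)) κ' +
        if r = i then 0 else coordUnit none κ'
    | .copy i j => 2 * coordUnit (some (if r = i then j else r, true)) κ' +
        coordUnit (some (if r = i then j else r, false)) κ' + coordUnit none κ'

theorem sum_mul_coordUnit (y : Coord V → ℝ) (κ : Coord V) :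
    ∑ κ', y κ' * (coordUnit κ κ' : ℝ) = y κ := by
  simp [coordUnit]

theorem sum_mul_two_mul_coordUnit (y : Coord V → ℝ) (κ : Coord V) :
    ∑ κ', y κ' * (2 * (coordUnit κ κ' : ℝ)) = 2 * y κ := by
  rw [← sum_mul_coordUnit y κ, Finset.mul_sum]
  exact Finset.sum_congr rfl fun _ _ => by ring

theorem regVec_opMat (op : RegOp V) (x : V → ℕ) (w : ℝ) (κ : Coord V) :
    ∑ κ', regVec x w κ' * (opMat op κ' κ : ℝ) = regVec (op.app x) (2 * w) κ := by
  match κ with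
  | none => simp only [opMat, sum_mul_coordUnit]; rfl
  | some (r, b) =>
    have key : regVec (op.app x) (2 * w) (some (r, b)) =
        if b then 2 * w - 1 - (op.app x r : ℝ) else (op.app x r : ℝ) := by cases b <;> rfl
    have hd (r : V) : regVec x w (some (r, true)) = w - 1 - x r := rfl
    have hc (r : V) : regVec x w (some (r, false)) = x r := rfl
    have ho : regVec x w none = 1 := rfl
    rw [key]
    cases b <;> cases op with
    | nop =>
      simp [-Fintype.sum_option, opMat, mul_add, Finset.sum_add_distrib, sum_mul_coordUnit,
        sum_mul_two_mul_coordUnit, RegOp.app, hc, hd, ho] <;> ring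
    | zero i =>
      by_cases h : r = i <;>
      simp [-Fintype.sum_option, opMat, h, mul_add, Finset.sum_add_distrib, sum_mul_coordUnit,
        sum_mul_two_mul_coordUnit, RegOp.app, hc, hd, ho] <;> ring
    | inc i =>
      by_cases h : r = i <;>
      simp [-Fintype.sum_option, opMat, h, mul_add, Finset.sum_add_distrib, sum_mul_coordUnit,
        sum_mul_two_mul_coordUnit, RegOp.app, hc, hd, ho] <;> ring
    | copy i j =>
      by_cases h : r = i <;>
      simp [-Fintype.sum_option, opMat, h, mul_add, Finset.sum_add_distrib, sum_mul_coordUnit,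
        sum_mul_two_mul_coordUnit, RegOp.app, hc, hd, ho] <;> ring

theorem sum_regVec (x : V → ℕ) (w : ℝ) :
    ∑ κ, regVec x w κ = 1 + Fintype.card V * (w - 1) := by
  rw [Fintype.sum_option, Fintype.sum_prod_type]
  simp [regVec, mul_sub]

/-- The row vector after the start-up chain. -/
def startCoeff (n : ℕ) (x₀ : V → ℕ) : Coord V → ℕ
  | none => 1
  | some (r, false) => x₀ r
  | some (r, true) => 2 ^ (n + 1) - 1 - x₀ r

/-- Adam's initial matrix: everything is sent to the beginning of the start-up chain. -/
def initMat (n : ℕ) : GameIndex Q V n → GameIndex Q V n → ℕ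
  | _, .inl _ => 0
  -- A restart must not profit Adam: `2 ^ n` covers the deficit allowed by `EveInv.le_sum`, and one
  -- more factor 2 pays for the round.
  | _, .inr i => if i = 0 then 2 ^ (n + 1) else 0

/-- Adam's matrix for the choice `a`. -/
def adamMat (S : Q → Instr V Q) (q₀ : Q) (n : ℕ) (x₀ : V → ℕ) (a : Bool) :
    GameIndex Q V n → GameIndex Q V n → ℕ
  -- A pending choice is always resolved by Eve, so the invariants never meet these rows at Adam's
  -- turn.
  | .inl ((_, some _), _), _ => 0
  | .inl ((q, none), κ), .inl (p, κ') => match S q with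
    | .le _ _ => 0
    | .step op _ => if p = (q, some a) then opMat op κ κ' else 0
  | .inl ((q, none), κ), .inr i => match S q with
    | .le r s => if i = 0 then 2 * (coordUnit (some (r, false)) κ + coordUnit (some (s, true)) κ)
        else 0
    | .step _ _ => 0
  | .inr i, .inl (p, κ') => if i.val = n ∧ p = (q₀, none) then startCoeff n x₀ κ' else 0
  | .inr i, .inr j => if j.val = i.val + 1 then 1 else 0

/-- The control state reached by Eve's choice `e`. -/
def eveNext (S : Q → Instr V Q) (e : Bool) : Q × Option Bool → Q × Option Bool
  | (q, none) => (q, none)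
  | (q, some a) => match S q with
    -- A default: Adam's matrices leave no pending choice at a comparison.
    | .le _ _ => (q, none)
    | .step _ next => (next a e, none)

/-- Eve's matrix for the choice `e`. -/
def eveMat (S : Q → Instr V Q) (n : ℕ) (e : Bool) : GameIndex Q V n → GameIndex Q V n → ℕ
  | .inl (p, κ), .inl (p', κ') => if p' = eveNext S e p ∧ κ' = κ then 1 else 0
  | .inr i, .inr j => if j = i then 1 else 0
  | _, _ => 0

/-- The product of a row vector and a matrix with natural entries. -/
def rowMul {I : Type} [Fintype I] (y : I → ℝ) (A : I → I → ℕ) (t : I) : ℝ := ∑ s, y s * (A s t : ℝ)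

/-- The game vector with register vector `v` in control block `p`. -/
def blockVec {n : ℕ} (p : Q × Option Bool) (v : Coord V → ℝ) : GameIndex Q V n → ℝ
  | .inl (p', κ) => if p' = p then v κ else 0
  | .inr _ => 0

/-- The game vector of a position of the start-up chain. -/
def chainVec {n : ℕ} (i : Fin (n + 1)) : GameIndex Q V n → ℝ
  | .inl _ => 0
  | .inr j => if j = i then 1 else 0

/-! ### Action of the matrices on block and chain vectors -/

theorem rowMul_smul {I : Type} [Fintype I] (c : ℝ) (y : I → ℝ) (A : I → I → ℕ) :
    rowMul (c • y) A = c • rowMul y A := by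
  funext t
  simp [rowMul, Finset.mul_sum, mul_assoc]

theorem rowMul_blockVec {n : ℕ} (p : Q × Option Bool) (v : Coord V → ℝ)
    (A : GameIndex Q V n → GameIndex Q V n → ℕ) (t : GameIndex Q V n) :
    rowMul (blockVec p v) A t = ∑ κ, v κ * (A (.inl (p, κ)) t : ℝ) := by
  rw [rowMul, Fintype.sum_sum_type, Fintype.sum_prod_type,
    Finset.sum_eq_single p (by intro b _ hb; simp [blockVec, hb]) (by simp)]
  simp [blockVec]

theorem rowMul_chainVec {n : ℕ} (i : Fin (n + 1)) (A : GameIndex Q V n → GameIndex Q V n → ℕ)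
    (t : GameIndex Q V n) : rowMul (chainVec i) A t = A (.inr i) t := by
  simp [rowMul, Fintype.sum_sum_type, chainVec]

theorem sum_blockVec {n : ℕ} (p : Q × Option Bool) (v : Coord V → ℝ) :
    ∑ t, blockVec (n := n) p v t = ∑ κ, v κ := by
  rw [Fintype.sum_sum_type, Fintype.sum_prod_type,
    Finset.sum_eq_single p (by intro b _ hb; simp [blockVec, hb]) (by simp)]
  simp [blockVec]

theorem sum_chainVec {n : ℕ} (i : Fin (n + 1)) : ∑ t, chainVec (Q := Q) (V := V) i t = 1 := by
  simp [Fintype.sum_sum_type, chainVec]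

variable (S : Q → Instr V Q) (q₀ : Q) (n : ℕ) (x₀ : V → ℕ)

theorem rowMul_initMat (y : GameIndex Q V n → ℝ) :
    rowMul y (initMat n) = (2 ^ (n + 1) * ∑ t, y t) • chainVec 0 := by
  funext t
  rcases t with t | i
  · simp [rowMul, initMat, chainVec]
  · have : ∀ s : GameIndex Q V n, initMat n s (.inr i) = if i = 0 then 2 ^ (n + 1) else 0 := by
      intro s; rfl
    simp only [rowMul, this, chainVec, Pi.smul_apply, smul_eq_mul]
    by_cases h : i = 0
    · simp only [h, if_true, mul_one, ← Finset.sum_mul]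
      push_cast
      ring
    · simp [h]

theorem rowMul_blockVec_eveMat (e : Bool) (p : Q × Option Bool) (v : Coord V → ℝ) :
    rowMul (blockVec p v) (eveMat S n e) = blockVec (eveNext S e p) v := by
  funext t
  rw [rowMul_blockVec]
  rcases t with ⟨p', κ⟩ | i
  · by_cases h : p' = eveNext S e p <;> simp [eveMat, blockVec, h]
  · simp [eveMat, blockVec]

theorem rowMul_chainVec_eveMat (e : Bool) (i : Fin (n + 1)) :
    rowMul (chainVec i) (eveMat S n e) = chainVec i := by
  funext t
  rw [rowMul_chainVec]
  rcases t with t | j <;> simp [eveMat, chainVec]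

variable {S} in
theorem rowMul_blockVec_adamMat_step {q : Q} {op : RegOp V} {next : Bool → Bool → Q}
    (h : S q = .step op next) (a : Bool) (x : V → ℕ) (w : ℝ) :
    rowMul (blockVec (q, none) (regVec x w)) (adamMat S q₀ n x₀ a) =
      blockVec (q, some a) (regVec (op.app x) (2 * w)) := by
  funext t
  rw [rowMul_blockVec]
  rcases t with ⟨p', κ⟩ | i
  · by_cases hp : p' = (q, some a)
    · simp [-Fintype.sum_option, adamMat, blockVec, h, hp, regVec_opMat]
    · simp [adamMat, blockVec, h, hp]
  · simp [adamMat, blockVec, h]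

variable {S} in
theorem rowMul_blockVec_adamMat_le {q : Q} {r s : V}
    (h : S q = .le r s) (a : Bool) (x : V → ℕ) (w : ℝ) :
    rowMul (blockVec (q, none) (regVec x w)) (adamMat S q₀ n x₀ a) =
      (2 * (x r + (w - 1 - x s))) • chainVec 0 := by
  funext t
  rw [rowMul_blockVec]
  rcases t with ⟨p', κ⟩ | i
  · simp [adamMat, chainVec, h]
  · by_cases hi : i = 0
    · have hd (r : V) : regVec x w (some (r, true)) = w - 1 - x r := rfl
      have hc (r : V) : regVec x w (some (r, false)) = x r := rfl
      simp [-Fintype.sum_option, adamMat, chainVec, h, hi, mul_add, Finset.sum_add_distrib,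
        sum_mul_two_mul_coordUnit, hc, hd]
    · simp [adamMat, chainVec, h, hi]

theorem rowMul_chainVec_adamMat_lt (a : Bool) {i : Fin (n + 1)} (hi : i.val < n) :
    rowMul (chainVec i) (adamMat S q₀ n x₀ a) = chainVec ⟨i.val + 1, by omega⟩ := by
  funext t
  rw [rowMul_chainVec]
  rcases t with t | j
  · simp [adamMat, chainVec, hi.ne]
  · simp [adamMat, chainVec, Fin.ext_iff]

theorem rowMul_chainVec_adamMat_last (a : Bool) {i : Fin (n + 1)} (hi : i.val = n)
    (hx₀ : ∀ r, x₀ r < 2 ^ (n + 1)) :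
    rowMul (chainVec i) (adamMat S q₀ n x₀ a) = blockVec (q₀, none) (regVec x₀ (2 ^ (n + 1))) := by
  funext t
  rw [rowMul_chainVec]
  rcases t with ⟨p, κ⟩ | j
  · by_cases hp : p = (q₀, none)
    · simp only [adamMat, hi, hp, and_self, if_true, blockVec]
      match κ with
      | none => simp [startCoeff, regVec]
      | some (r, false) => simp [startCoeff, regVec]
      | some (r, true) =>
        have := hx₀ r
        simp only [startCoeff, regVec]
        rw [Nat.cast_sub (by omega), Nat.cast_sub (by omega)]
        push_cast
        ring
    · simp [adamMat, blockVec, hp]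
  · have : j.val ≠ n + 1 := by omega
    simp [adamMat, blockVec, hi, this]

end Game

end MMG

namespace MMG

section GameValue

set_option linter.unusedSectionVars false

variable {V Q : Type} [Fintype V] [DecidableEq V] [Fintype Q] [DecidableEq Q]

/-! ### Rounds of the game -/

/-- The number of rows of the matrices. -/
abbrev gameDim (Q V : Type) [Fintype V] [Fintype Q] (n : ℕ) : ℕ :=
  Fintype.card ((Q × Option Bool) × Coord V) + (n + 1)

/-- The numbering of the coordinates. -/
noncomputable def indexEquiv (Q V : Type) [Fintype V] [Fintype Q] (n : ℕ) :
    GameIndex Q V n ≃ Fin (gameDim Q V n) :=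
  (Equiv.sumCongr (Fintype.equivFin _) (Equiv.refl _)).trans finSumFinEquiv

/-- The matrix with given entries. -/
noncomputable def toMat {n : ℕ} (A : GameIndex Q V n → GameIndex Q V n → ℕ) :
    Matrix (Fin (gameDim Q V n)) (Fin (gameDim Q V n)) ℕ :=
  Matrix.of fun i j => A ((indexEquiv Q V n).symm i) ((indexEquiv Q V n).symm j)

/-- The list of Adam's matrices. -/
noncomputable def adamList (S : Q → Instr V Q) (q₀ : Q) (n : ℕ) (x₀ : V → ℕ) :
    List (Matrix (Fin (gameDim Q V n)) (Fin (gameDim Q V n)) ℕ) :=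
  [toMat (initMat n), toMat (adamMat S q₀ n x₀ true), toMat (adamMat S q₀ n x₀ false)]

/-- The list of Eve's matrices. -/
noncomputable def eveList (S : Q → Instr V Q) (n : ℕ) :
    List (Matrix (Fin (gameDim Q V n)) (Fin (gameDim Q V n)) ℕ) :=
  [toMat (eveMat S n true), toMat (eveMat S n false)]

/-- The matrix multiplication game in which Adam tries to force a successful comparison. -/
noncomputable def systemGame (S : Q → Instr V Q) (q₀ : Q) (n : ℕ) (x₀ : V → ℕ) : NatGame where
  m := gameDim Q V n
  n := gameDim Q V n
  m_pos := by simp [gameDim]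
  n_pos := by simp [gameDim]
  adam := (adamList S q₀ n x₀).toFinset
  eve := (eveList S n).toFinset
  adam_nonempty := ⟨_, List.mem_toFinset.2 List.mem_cons_self⟩
  eve_nonempty := ⟨_, List.mem_toFinset.2 List.mem_cons_self⟩

variable {S : Q → Instr V Q} {q₀ : Q} {n : ℕ} {x₀ : V → ℕ}

theorem mem_adamList_iff {B : Matrix (Fin (gameDim Q V n)) (Fin (gameDim Q V n)) ℕ} :
    B ∈ adamList S q₀ n x₀ ↔ B = toMat (initMat n) ∨ ∃ a, B = toMat (adamMat S q₀ n x₀ a) := by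
  simp [adamList, or_comm]

theorem mem_eveList_iff {B : Matrix (Fin (gameDim Q V n)) (Fin (gameDim Q V n)) ℕ} :
    B ∈ eveList S n ↔ ∃ e, B = toMat (eveMat S n e) := by
  simp [eveList, or_comm]

/-- The matrix with given natural entries, as a real matrix. -/
noncomputable def toRealMat (A : GameIndex Q V n → GameIndex Q V n → ℕ) :
    Matrix (Fin (gameDim Q V n)) (Fin (gameDim Q V n)) ℝ :=
  (toMat A).map fun a : ℕ => (a : ℝ)

theorem vecMul_toRealMat (A : GameIndex Q V n → GameIndex Q V n → ℕ)
    (y : Fin (gameDim Q V n) → ℝ) :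
    (Matrix.vecMul y (toRealMat A)) ∘ indexEquiv Q V n =
      rowMul (y ∘ indexEquiv Q V n) A := by
  funext t
  simp only [Function.comp_apply, Matrix.vecMul, dotProduct, rowMul, Matrix.map_apply, toMat,
    toRealMat, Matrix.of_apply, Equiv.symm_apply_apply]
  rw [← (indexEquiv Q V n).sum_comp]
  simp

/-- The real matrices of Adam. -/
def adamRealSet (S : Q → Instr V Q) (q₀ : Q) (n : ℕ) (x₀ : V → ℕ) :
    Set (Matrix (Fin (gameDim Q V n)) (Fin (gameDim Q V n)) ℝ) :=
  {A | A = toRealMat (initMat n) ∨ ∃ a, A = toRealMat (adamMat S q₀ n x₀ a)}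

/-- The real matrices of Eve. -/
def eveRealSet (S : Q → Instr V Q) (n : ℕ) :
    Set (Matrix (Fin (gameDim Q V n)) (Fin (gameDim Q V n)) ℝ) :=
  {E | ∃ e, E = toRealMat (eveMat S n e)}

theorem systemGame_adamSet : (systemGame S q₀ n x₀).adamSet = adamRealSet S q₀ n x₀ := by
  refine Set.Subset.antisymm ?_ ?_
  · rintro A ⟨B, hB, rfl⟩
    rcases mem_adamList_iff.1 (List.mem_toFinset.1 hB) with h | ⟨a, h⟩
    · exact .inl (congrArg (fun B => B.map fun a : ℕ => (a : ℝ)) h)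
    · exact .inr ⟨a, congrArg (fun B => B.map fun a : ℕ => (a : ℝ)) h⟩
  · rintro A (h | ⟨a, h⟩)
    · exact ⟨_, List.mem_toFinset.2 (mem_adamList_iff.2 (.inl rfl)), h⟩
    · exact ⟨_, List.mem_toFinset.2 (mem_adamList_iff.2 (.inr ⟨a, rfl⟩)), h⟩

theorem systemGame_eveSet : (systemGame S q₀ n x₀).eveSet = eveRealSet S n := by
  refine Set.Subset.antisymm ?_ ?_
  · rintro E ⟨B, hB, rfl⟩
    obtain ⟨e, h⟩ := mem_eveList_iff.1 (List.mem_toFinset.1 hB)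
    exact ⟨e, congrArg (fun B => B.map fun a : ℕ => (a : ℝ)) h⟩
  · rintro E ⟨e, h⟩
    exact ⟨_, List.mem_toFinset.2 (mem_eveList_iff.2 ⟨e, rfl⟩), h⟩

theorem maxEvePayoff_systemGame : (systemGame S q₀ n x₀).maxEvePayoff =
    eveValue (adamRealSet S q₀ n x₀) (eveRealSet S n) := by
  have h : (systemGame S q₀ n x₀).maxEvePayoff =
    eveValue (systemGame S q₀ n x₀).adamSet (systemGame S q₀ n x₀).eveSet := rfl
  rw [h, systemGame_adamSet, systemGame_eveSet]
  rfl

theorem round_init (y : GameIndex Q V n → ℝ) (e : Bool) :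
    rowMul (rowMul y (initMat n)) (eveMat S n e) = (2 ^ (n + 1) * ∑ t, y t) • chainVec 0 := by
  rw [rowMul_initMat, rowMul_smul, rowMul_chainVec_eveMat]

theorem round_chain_lt (c : ℝ) (a e : Bool) {i : Fin (n + 1)} (hi : i.val < n) :
    rowMul (rowMul (c • chainVec i) (adamMat S q₀ n x₀ a)) (eveMat S n e) =
      c • chainVec ⟨i.val + 1, by omega⟩ := by
  rw [rowMul_smul, rowMul_smul, rowMul_chainVec_adamMat_lt _ _ _ _ _ hi, rowMul_chainVec_eveMat]

theorem round_chain_last (c : ℝ) (a e : Bool) {i : Fin (n + 1)} (hi : i.val = n)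
    (hx₀ : ∀ r, x₀ r < 2 ^ (n + 1)) :
    rowMul (rowMul (c • chainVec i) (adamMat S q₀ n x₀ a)) (eveMat S n e) =
      c • blockVec (q₀, none) (regVec x₀ (2 ^ (n + 1))) := by
  rw [rowMul_smul, rowMul_smul, rowMul_chainVec_adamMat_last _ _ _ _ _ hi hx₀,
    rowMul_blockVec_eveMat]
  rfl

theorem round_step {q : Q} {op : RegOp V} {next : Bool → Bool → Q} (h : S q = .step op next)
    (c : ℝ) (a e : Bool) (x : V → ℕ) (w : ℝ) :
    rowMul (rowMul (c • blockVec (q, none) (regVec x w)) (adamMat S q₀ n x₀ a)) (eveMat S n e) =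
      c • blockVec (next a e, none) (regVec (op.app x) (2 * w)) := by
  rw [rowMul_smul, rowMul_smul, rowMul_blockVec_adamMat_step _ _ _ h, rowMul_blockVec_eveMat]
  simp [eveNext, h]

theorem round_le {q : Q} {r s : V} (h : S q = .le r s)
    (c : ℝ) (a e : Bool) (x : V → ℕ) (w : ℝ) :
    rowMul (rowMul (c • blockVec (q, none) (regVec x w)) (adamMat S q₀ n x₀ a)) (eveMat S n e) =
      (c * (2 * (x r + (w - 1 - x s)))) • chainVec 0 := by
  rw [rowMul_smul, rowMul_smul, rowMul_blockVec_adamMat_le _ _ _ h, rowMul_smul,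
    rowMul_chainVec_eveMat, smul_smul]

/-- An increment adds only 1 while the scale, which is at least 1, doubles. Hence complements stay
non-negative. -/
theorem RegOp.app_add_one_le {op : RegOp V} {x : V → ℕ} {w : ℝ} (h : ∀ r, (x r : ℝ) + 1 ≤ w)
    (r : V) : ((op.app x r : ℕ) : ℝ) + 1 ≤ 2 * w := by
  have h0 (r : V) : (0 : ℝ) ≤ x r := Nat.cast_nonneg _
  cases op with
  | nop => have := h r; have := h0 r; simp only [RegOp.app]; linarith
  | zero i =>
    have := h r; have := h0 r
    simp only [RegOp.app, Function.update_apply]; split_ifs <;> push_cast <;> linarith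
  | inc i =>
    have := h r; have := h0 r; have := h i; have := h0 i
    simp only [RegOp.app, Function.update_apply]; split_ifs <;> push_cast <;> linarith
  | copy i j =>
    have := h r; have := h0 r; have := h j; have := h0 j
    simp only [RegOp.app, Function.update_apply]; split_ifs <;> linarith

/-! ### The value when Adam cannot force a successful comparison -/

/-- Eve's invariant after `k` rounds: the current row vector is a multiple of a position of the
chain, or of a configuration that is not provable, and has grown by a factor of `2` per round. -/
def EveInv (S : Q → Instr V Q) (n k : ℕ) (y : GameIndex Q V n → ℝ) : Prop :=
  ∃ c : ℝ, 0 ≤ c ∧ ((∃ i : Fin (n + 1), y = c • chainVec i ∧ 2 ^ k ≤ c * 2 ^ i.val) ∨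
    ∃ q x w, y = c • blockVec (q, none) (regVec x w) ∧ ¬ Prov S q x ∧
      (∀ r, (x r : ℝ) + 1 ≤ w) ∧ 2 ^ k ≤ c * w)

/-- On the chain the deficit is at most `2 ^ n`. On a register vector there is none: content and
complement of a single register, together with the constant 1, already sum to `w`. -/
theorem EveInv.le_sum [Nonempty V] {k : ℕ} {y : GameIndex Q V n → ℝ} (h : EveInv S n k y) :
    2 ^ k ≤ 2 ^ n * ∑ t, y t := by
  obtain ⟨c, hc, ⟨i, rfl, hk⟩ | ⟨q, x, w, rfl, -, hx, hk⟩⟩ := h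
  · simp only [Pi.smul_apply, smul_eq_mul, ← Finset.mul_sum, sum_chainVec, mul_one]
    refine hk.trans ?_
    rw [mul_comm]
    gcongr
    · norm_num
    · omega
  · simp only [Pi.smul_apply, smul_eq_mul, ← Finset.mul_sum, sum_blockVec, sum_regVec]
    have hV : (1 : ℝ) ≤ Fintype.card V := by exact_mod_cast Fintype.card_pos
    have hw : 1 ≤ w := by
      have := hx (Classical.arbitrary V)
      have : (0 : ℝ) ≤ x (Classical.arbitrary V) := Nat.cast_nonneg _
      linarith
    have h1 : w ≤ 1 + Fintype.card V * (w - 1) := by nlinarith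
    have h2 : c * w ≤ c * (1 + Fintype.card V * (w - 1)) := mul_le_mul_of_nonneg_left h1 hc
    have h3 : (1 : ℝ) ≤ 2 ^ n := one_le_pow₀ (by norm_num)
    have h4 : (0 : ℝ) ≤ c * (1 + Fintype.card V * (w - 1)) := by positivity
    nlinarith

theorem EveInv.round_init [Nonempty V] {k : ℕ} {y : GameIndex Q V n → ℝ} (h : EveInv S n k y)
    (e : Bool) : EveInv S n (k + 1) (rowMul (rowMul y (initMat n)) (eveMat S n e)) := by
  have hs := h.le_sum
  have hp : (0 : ℝ) < 2 ^ k := by positivity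
  refine ⟨2 ^ (n + 1) * ∑ t, y t, ?_, .inl ⟨0, MMG.round_init y e, ?_⟩⟩
  · rw [pow_succ]; linarith
  · rw [pow_succ, pow_succ, Fin.val_zero, pow_zero, mul_one]; linarith

theorem EveInv.round_adamMat {k : ℕ} {y : GameIndex Q V n → ℝ} (h : EveInv S n k y)
    (hx₀ : ∀ r, x₀ r < 2 ^ (n + 1)) (h₀ : ¬ Prov S q₀ x₀) (a : Bool) :
    ∃ e, EveInv S n (k + 1) (rowMul (rowMul y (adamMat S q₀ n x₀ a)) (eveMat S n e)) := by
  obtain ⟨c, hc, ⟨i, rfl, hk⟩ | ⟨q, x, w, rfl, hp, hx, hk⟩⟩ := h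
  · refine ⟨true, c, hc, ?_⟩
    rcases Nat.lt_or_ge i.val n with hi | hi
    · refine .inl ⟨_, round_chain_lt c a true hi, ?_⟩
      simp only [pow_succ]
      linarith
    · have hi : i.val = n := by omega
      refine .inr ⟨q₀, x₀, _, round_chain_last c a true hi hx₀, h₀, fun r => ?_, ?_⟩
      · exact_mod_cast hx₀ r
      · rw [hi] at hk
        simp only [pow_succ]
        linarith
  · cases hS : S q with
    | le r s =>
      rw [prov_le_iff hS, not_le] at hp
      -- Integrality: a failed comparison fails by a whole unit, which cancels the `- 1` in the
      -- complement.
      have hp : (x s : ℝ) + 1 ≤ x r := by exact_mod_cast hp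
      refine ⟨true, _, ?_, .inl ⟨0, round_le hS c a true x w, ?_⟩⟩
      · have := hx s
        exact mul_nonneg hc (by linarith [(Nat.cast_nonneg (x r) : (0 : ℝ) ≤ x r)])
      · have : c * w ≤ c * (x r + (w - 1 - x s)) := mul_le_mul_of_nonneg_left (by linarith) hc
        simp [pow_succ]
        linarith
    | step op next =>
      rw [prov_step_iff hS] at hp
      push Not at hp
      obtain ⟨e, he⟩ := hp a
      refine ⟨e, c, hc, .inr ⟨_, _, _, round_step hS c a e x w, he,
        RegOp.app_add_one_le hx, ?_⟩⟩
      rw [pow_succ]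
      linarith

theorem sum_comp_indexEquiv (y : Fin (gameDim Q V n) → ℝ) :
    ∑ t, (y ∘ indexEquiv Q V n) t = ∑ j, y j :=
  (indexEquiv Q V n).sum_comp y

theorem two_le_eveValue [Nonempty V] (hx₀ : ∀ r, x₀ r < 2 ^ (n + 1)) (h₀ : ¬ Prov S q₀ x₀) :
    2 ≤ eveValue (adamRealSet S q₀ n x₀) (eveRealSet S n) := by
  have hu : (Pi.single (indexEquiv Q V n (.inr 0)) 1 : Fin (gameDim Q V n) → ℝ) ∘
      indexEquiv Q V n = chainVec 0 := by
    funext t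
    rcases t with t | i
    · simp [chainVec]
    · simp [chainVec, Pi.single_apply]
  obtain ⟨τ, hτ⟩ := exists_eveStrategy (𝒜 := adamRealSet S q₀ n x₀) (ℰ := eveRealSet S n)
    ⟨_, true, rfl⟩
    (Inv := fun k y => EveInv S n k (y ∘ indexEquiv Q V n))
    (u := Pi.single (indexEquiv Q V n (.inr 0)) 1)
    ⟨1, zero_le_one, .inl ⟨0, by rw [hu, one_smul], by simp⟩⟩ (by
      rintro k y hy A (rfl | ⟨a, rfl⟩)
      · refine ⟨_, ⟨true, rfl⟩, ?_⟩
        rw [vecMul_toRealMat, vecMul_toRealMat]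
        exact hy.round_init true
      · obtain ⟨e, he⟩ := hy.round_adamMat hx₀ h₀ a
        refine ⟨_, ⟨e, rfl⟩, ?_⟩
        rw [vecMul_toRealMat, vecMul_toRealMat]
        exact he)
  refine le_sSup ⟨τ, fun σ => ?_⟩
  have : (2 : ℝ≥0∞) = ENNReal.ofReal 2 := by simp
  rw [this]
  -- The constant is the deficit from `EveInv.le_sum`; it disappears in the `k`-th root.
  refine le_payoff (C := (2 ^ n)⁻¹) (by positivity) two_pos fun k => ?_
  have h1 := (hτ σ k).le_sum
  have h2 := sum_vecMul_single_le_oneNorm (indexEquiv Q V n (.inr 0))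
    (partialProduct (play σ τ) k)
  rw [sum_comp_indexEquiv] at h1
  rw [inv_mul_le_iff₀ (by positivity)]
  exact h1.trans (mul_le_mul_of_nonneg_left h2 (by positivity))

/-! ### The value when Adam can force a successful comparison -/

/-- Adam's invariant after `k` rounds. -/
def AdamInv (S : Q → Instr V Q) (n T : ℕ) (C δ : ℝ) (k : ℕ) (y : GameIndex Q V n → ℝ) : Prop :=
  ∃ c : ℝ, 0 ≤ c ∧
    ((∃ i : Fin (n + 1), y = c • chainVec i ∧ c * (2 * δ) ^ i.val ≤ C * (2 * δ) ^ k) ∨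
    ∃ q x t h, y = c • blockVec (q, none) (regVec x (2 ^ t)) ∧ ProvWithin S h q x ∧ h + t ≤ T ∧
      (∀ r, (x r : ℝ) + 1 ≤ 2 ^ t) ∧ c * (2 * δ) ^ t ≤ C * (2 * δ) ^ k)

/-- Here `t` counts the rounds of the current cycle and `h` bounds what remains, so `T` bounds their
sum. The saving comes only at the closing comparison, and `hδT` spreads it over the at most `T + 1`
rounds of the cycle. -/
theorem AdamInv.round {T h₀ k : ℕ} {C δ : ℝ} {y : GameIndex Q V n → ℝ}
    (hy : AdamInv S n T C δ k y) (hδ : 0 < δ) (hδ1 : δ ≤ 1)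
    (hδT : 1 - (1 / 2) ^ T ≤ δ ^ (T + 1))
    (hx₀ : ∀ r, x₀ r < 2 ^ (n + 1)) (hp₀ : ProvWithin S h₀ q₀ x₀) (hT : h₀ + (n + 1) ≤ T) :
    ∃ a, ∀ e, AdamInv S n T C δ (k + 1)
      (rowMul (rowMul y (adamMat S q₀ n x₀ a)) (eveMat S n e)) := by
  have hstep {c : ℝ} {t : ℕ} (hk : c * (2 * δ) ^ t ≤ C * (2 * δ) ^ k) :
      c * (2 * δ) ^ (t + 1) ≤ C * (2 * δ) ^ (k + 1) := by
    rw [pow_succ (2 * δ) t, pow_succ (2 * δ) k, ← mul_assoc, ← mul_assoc C]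
    exact mul_le_mul_of_nonneg_right hk (by positivity)
  obtain ⟨c, hc, ⟨i, rfl, hk⟩ | ⟨q, x, t, h, rfl, hp, ht, hx, hk⟩⟩ := hy
  · refine ⟨true, fun e => ⟨c, hc, ?_⟩⟩
    rcases Nat.lt_or_ge i.val n with hi | hi
    · exact .inl ⟨_, round_chain_lt c true e hi, hstep hk⟩
    · have hi : i.val = n := by omega
      refine .inr ⟨q₀, x₀, n + 1, h₀, round_chain_last c true e hi hx₀, hp₀, hT, fun r => ?_, ?_⟩
      · exact_mod_cast hx₀ r
      · rw [hi] at hk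
        exact hstep hk
  · cases h with
    | zero => exact hp.elim
    | succ h =>
      cases hS : S q with
      | le r s =>
        rw [provWithin_succ_le hS] at hp
        have hp : (x r : ℝ) ≤ x s := by exact_mod_cast hp
        refine ⟨true, fun e => ⟨_, ?_, .inl ⟨0, round_le hS c true e x _, ?_⟩⟩⟩
        · have := hx s
          exact mul_nonneg hc (by linarith [(Nat.cast_nonneg (x r) : (0 : ℝ) ≤ x r)])
        -- Since `t ≤ T`, one has `1 - 2⁻ᵗ ≤ 1 - 2⁻ᵀ ≤ δ ^ (T + 1) ≤ δ ^ (t + 1)`.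
        · have h1 : (2 : ℝ) ^ t - 1 ≤ 2 ^ t * δ ^ (t + 1) := by
            have h2 : δ ^ (T + 1) ≤ δ ^ (t + 1) := pow_le_pow_of_le_one hδ.le hδ1 (by omega)
            have h3 : (1 / 2 : ℝ) ^ T ≤ (1 / 2) ^ t :=
              pow_le_pow_of_le_one (by norm_num) (by norm_num) (by omega)
            have h4 : (2 : ℝ) ^ t * (1 / 2) ^ t = 1 := by rw [← mul_pow]; norm_num
            have h5 : (0 : ℝ) < 2 ^ t := by positivity
            nlinarith
          rw [Fin.val_zero, pow_zero, mul_one]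
          calc c * (2 * (x r + (2 ^ t - 1 - x s)))
              ≤ c * (2 * (2 ^ t * δ ^ (t + 1))) := by
                refine mul_le_mul_of_nonneg_left ?_ hc
                linarith
            _ = c * (2 * δ) ^ (t + 1) := by rw [mul_pow, pow_succ 2]; ring
            _ ≤ _ := hstep hk
      | step op next =>
        rw [provWithin_succ_step hS] at hp
        obtain ⟨a, ha⟩ := hp
        refine ⟨a, fun e => ⟨c, hc, .inr ⟨_, _, t + 1, h, ?_, ha e, by omega, ?_, hstep hk⟩⟩⟩
        · rw [round_step hS, pow_succ, mul_comm 2]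
        · rw [pow_succ, mul_comm]
          exact RegOp.app_add_one_le hx

/-- Within a cycle the vector may run ahead of the rate `2 * δ`, but by no more than `δ⁻¹` per
round, hence by at most `δ ^ T` inverted. -/
theorem AdamInv.sum_le [Nonempty V] {T k : ℕ} {C δ : ℝ} {y : GameIndex Q V n → ℝ}
    (hy : AdamInv S n T C δ k y) (hδ : 0 < δ) (hδ1 : δ ≤ 1) (hT : n ≤ T) :
    δ ^ T * ∑ t, y t ≤ C * Fintype.card V * (2 * δ) ^ k := by
  have hV : (1 : ℝ) ≤ Fintype.card V := by exact_mod_cast Fintype.card_pos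
  have key {c : ℝ} {t : ℕ} (hc : 0 ≤ c) (ht : t ≤ T) (hk : c * (2 * δ) ^ t ≤ C * (2 * δ) ^ k) :
      δ ^ T * (c * (Fintype.card V * 2 ^ t)) ≤ C * Fintype.card V * (2 * δ) ^ k := by
    have h1 : δ ^ T ≤ δ ^ t := pow_le_pow_of_le_one hδ.le hδ1 ht
    calc δ ^ T * (c * (Fintype.card V * 2 ^ t)) ≤ δ ^ t * (c * (Fintype.card V * 2 ^ t)) :=
          mul_le_mul_of_nonneg_right h1 (by positivity)
      _ = Fintype.card V * (c * (2 * δ) ^ t) := by rw [mul_pow]; ring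
      _ ≤ Fintype.card V * (C * (2 * δ) ^ k) := mul_le_mul_of_nonneg_left hk (by positivity)
      _ = _ := by ring
  obtain ⟨c, hc, ⟨i, rfl, hk⟩ | ⟨q, x, t, h, rfl, hp, ht, hx, hk⟩⟩ := hy
  · refine le_trans ?_ (key hc (by omega) hk)
    simp only [Pi.smul_apply, smul_eq_mul, ← Finset.mul_sum, sum_chainVec]
    have h2 : (1 : ℝ) ≤ 2 ^ i.val := one_le_pow₀ (by norm_num)
    gcongr
    nlinarith
  · refine le_trans ?_ (key hc (by omega) hk)
    simp only [Pi.smul_apply, smul_eq_mul, ← Finset.mul_sum, sum_blockVec, sum_regVec]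
    gcongr
    linarith

/-- Bernoulli's inequality for a `δ` so close to 1 that `T + 1` steps lose at most `2⁻ᵀ`. -/
theorem exists_contraction (T : ℕ) :
    ∃ δ : ℝ, 0 < δ ∧ δ < 1 ∧ 1 - (1 / 2) ^ T ≤ δ ^ (T + 1) := by
  have h1 : (0 : ℝ) < (1 / 2) ^ T := by positivity
  have h2 : (1 / 2 : ℝ) ^ T ≤ 1 := pow_le_one₀ (by norm_num) (by norm_num)
  have h3 : (0 : ℝ) < T + 1 := by positivity
  have h4 : (1 / 2 : ℝ) ^ T / (T + 2) < 1 := by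
    rw [div_lt_one (by positivity)]
    linarith
  have h5 : (0 : ℝ) < (1 / 2) ^ T / (T + 2) := by positivity
  refine ⟨1 - (1 / 2) ^ T / (T + 2), by linarith, by linarith, ?_⟩
  have := one_add_mul_le_pow (a := -((1 / 2 : ℝ) ^ T / (T + 2))) (by linarith) (T + 1)
  rw [← sub_eq_add_neg] at this
  refine le_trans ?_ this
  have h6 : ((T : ℝ) + 1) * ((1 / 2 : ℝ) ^ T / (T + 2)) ≤ (1 / 2) ^ T := by
    rw [mul_div_assoc', div_le_iff₀ (by positivity)]
    nlinarith
  push_cast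
  linarith

theorem toRealMat_nonneg (A : GameIndex Q V n → GameIndex Q V n → ℕ)
    (i j : Fin (gameDim Q V n)) : 0 ≤ toRealMat A i j :=
  Nat.cast_nonneg _

theorem eveValue_lt_two [Nonempty V] (hx₀ : ∀ r, x₀ r < 2 ^ (n + 1)) (hp : Prov S q₀ x₀) :
    eveValue (adamRealSet S q₀ n x₀) (eveRealSet S n) < 2 := by
  obtain ⟨h₀, hp₀⟩ := hp.exists_provWithin
  obtain ⟨T, hT⟩ : ∃ T, T = h₀ + (n + 1) := ⟨_, rfl⟩
  obtain ⟨δ, hδ, hδ1, hδT⟩ := exists_contraction T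
  -- The weight at the chain start after the initial matrix has acted on the all-ones vector.
  let C : ℝ := 2 ^ (n + 1) * Fintype.card (GameIndex Q V n)
  have hC : 0 < C := by
    have : (0 : ℝ) < Fintype.card (GameIndex Q V n) := by exact_mod_cast Fintype.card_pos
    positivity
  obtain ⟨σ, hσ⟩ := exists_adamStrategy (𝒜 := adamRealSet S q₀ n x₀) (ℰ := eveRealSet S n)
    ⟨_, .inl rfl⟩
    -- Round 0 is spent on the initial matrix, so `AdamInv` lags by one round; this explains the
    -- division by `2 * δ` in the final constant.
    (Inv := fun k y => match k with
      | 0 => y = 1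
      | k + 1 => AdamInv S n T C δ k (y ∘ indexEquiv Q V n))
    (u := 1) rfl (by
      intro k y hy
      cases k with
      | zero =>
        refine ⟨_, .inl rfl, ?_⟩
        rintro E ⟨e, rfl⟩
        simp only at hy
        subst hy
        simp only [vecMul_toRealMat]
        rw [round_init]
        refine ⟨C, hC.le, .inl ⟨0, ?_, by simp⟩⟩
        simp [C]
      | succ k =>
        obtain ⟨a, ha⟩ := AdamInv.round hy hδ hδ1.le hδT hx₀ hp₀ hT.ge
        refine ⟨_, .inr ⟨a, rfl⟩, ?_⟩
        rintro E ⟨e, rfl⟩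
        simp only [vecMul_toRealMat]
        exact ha e)
  have hbound : eveValue (adamRealSet S q₀ n x₀) (eveRealSet S n) ≤ ENNReal.ofReal (2 * δ) := by
    refine sSup_le fun v ⟨τ, hτ⟩ => (hτ σ).trans ?_
    have hnorm (k : ℕ) : oneNorm (partialProduct (play σ τ) k) =
        ∑ j, (Matrix.vecMul 1 (partialProduct (play σ τ) k)) j := by
      refine oneNorm_eq_sum_vecMul_one (partialProduct_nonneg ?_ ?_ _ _)
      · rintro A (rfl | ⟨a, rfl⟩) <;> exact toRealMat_nonneg _
      · rintro E ⟨e, rfl⟩; exact toRealMat_nonneg _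
    -- The summand `gameDim Q V n` takes care of `k = 0`, where the product is the identity matrix.
    refine payoff_le (C := gameDim Q V n + C * Fintype.card V / δ ^ T / (2 * δ))
      (by positivity) (by positivity) fun k => ?_
    rw [hnorm]
    cases k with
    | zero =>
      have : 0 ≤ C * Fintype.card V / δ ^ T / (2 * δ) := by positivity
      simp [partialProduct]
      simpa using this
    | succ k =>
      have h1 := AdamInv.sum_le (hσ τ (k + 1)) hδ hδ1.le (by omega)
      rw [sum_comp_indexEquiv] at h1
      have h2 : (0 : ℝ) ≤ gameDim Q V n * (2 * δ) ^ (k + 1) := by positivity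
      rw [add_mul]
      refine le_trans ?_ (le_add_of_nonneg_left h2)
      rw [pow_succ, div_mul_eq_mul_div, le_div_iff₀ (by positivity), div_mul_eq_mul_div,
        le_div_iff₀ (by positivity)]
      nlinarith
  refine hbound.trans_lt ?_
  have : (2 : ℝ≥0∞) = ENNReal.ofReal 2 := by simp
  rw [this]
  exact (ENNReal.ofReal_lt_ofReal_iff two_pos).2 (by linarith)

theorem maxEvePayoff_lt_two_iff [Nonempty V] (hx₀ : ∀ r, x₀ r < 2 ^ (n + 1)) :
    (systemGame S q₀ n x₀).maxEvePayoff < 2 ↔ Prov S q₀ x₀ := by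
  rw [maxEvePayoff_systemGame]
  exact ⟨fun h => by_contra fun hp => (two_le_eveValue hx₀ hp).not_gt h, eveValue_lt_two hx₀⟩

end GameValue

end MMG

namespace MMG

/-! ### Computability of the reduction -/

theorem matrixCode_injective {m n : ℕ} :
    Function.Injective (matrixCode : Matrix (Fin m) (Fin n) ℕ → List (List ℕ)) := by
  intro A B h
  have h := List.ofFn_injective h
  funext i j
  exact congrFun (List.ofFn_injective (congrFun h i)) j

/-- A code describes at most one game. -/
theorem IsCodeOf.unique {c : GameCode} {G G' : NatGame} (h : IsCodeOf c G) (h' : IsCodeOf c G') :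
    G = G' := by
  obtain ⟨As, Es, hA, hE, rfl⟩ := h
  obtain ⟨As', Es', hA', hE', hc⟩ := h'
  obtain ⟨m, n, hm, hn, adam, eve, ha, he⟩ := G
  obtain ⟨m', n', hm', hn', adam', eve', ha', he'⟩ := G'
  simp only [Prod.mk.injEq] at hc
  obtain ⟨rfl, rfl, h1, h2⟩ := hc
  have h1 := List.map_injective_iff.2 matrixCode_injective h1
  have h2 := List.map_injective_iff.2 matrixCode_injective h2
  subst h1 h2
  have e1 : adam = adam' := Finset.ext fun B => (hA B).symm.trans (hA' B)
  have e2 : eve = eve' := Finset.ext fun B => (hE B).symm.trans (hE' B)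
  subst e1 e2
  rfl

section Code

set_option linter.unusedSectionVars false

variable {V Q : Type} [Fintype V] [DecidableEq V] [Fintype Q] [DecidableEq Q]

/-- A family of matrices, indexed by the length of the start-up chain, whose entries are primitive
recursive. -/
structure PrimrecFamily (A : ∀ n, GameIndex Q V n → GameIndex Q V n → ℕ) : Prop where
  fixed : ∀ f g, Primrec fun n => A n (.inl f) (.inl g)
  toChain : ∀ f, ∃ u : ℕ → ℕ → ℕ, Primrec₂ u ∧ ∀ n i, A n (.inl f) (.inr i) = u n i.val
  ofChain : ∀ g, ∃ u : ℕ → ℕ → ℕ, Primrec₂ u ∧ ∀ n i, A n (.inr i) (.inl g) = u n i.val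
  chain : ∃ u : ℕ × ℕ → ℕ → ℕ, Primrec₂ u ∧ ∀ n i j, A n (.inr i) (.inr j) = u (n, i.val) j.val

theorem ofFn_val_eq_map_range {α : Type} (k : ℕ) (g : ℕ → α) :
    (List.ofFn fun j : Fin k => g j.val) = (List.range k).map g := by
  apply List.ext_getElem <;> simp

theorem PrimrecFamily.primrec_matrixCode {A : ∀ n, GameIndex Q V n → GameIndex Q V n → ℕ}
    (hA : PrimrecFamily A) : Primrec fun n => matrixCode (toMat (A n)) := by
  obtain ⟨hT, hU, hW, Z, hZ, hZA⟩ := hA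
  choose U hU hUA using hU
  choose W hW hWA using hW
  let e := (Fintype.equivFin ((Q × Option Bool) × Coord V)).symm
  -- The numbering puts the fixed finite block first and the chain last, so each matrix consists of
  -- fixed-length lists followed by maps over `List.range (n + 1)`.
  have hcode (n : ℕ) : matrixCode (toMat (A n)) =
      (List.ofFn fun i => (List.ofFn fun j => A n (.inl (e i)) (.inl (e j))) ++
        (List.range (n + 1)).map fun j => U (e i) n j) ++
      (List.range (n + 1)).map fun i => (List.ofFn fun j => W (e j) n i) ++
        (List.range (n + 1)).map fun j => Z (n, i) j := by
    have hl (i : Fin (Fintype.card ((Q × Option Bool) × Coord V))) :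
        (indexEquiv Q V n).symm (Fin.castAdd (n + 1) i) = .inl (e i) := by
      simp [indexEquiv, e]
    have hr (i : Fin (n + 1)) : (indexEquiv Q V n).symm (Fin.natAdd _ i) = .inr i := by
      simp [indexEquiv]
    have hsplit {α : Type} (f : Fin (gameDim Q V n) → α) : List.ofFn f =
        (List.ofFn fun i => f (Fin.castAdd (n + 1) i)) ++ List.ofFn fun i => f (Fin.natAdd _ i) :=
      List.ofFn_add
    simp only [matrixCode, hsplit, toMat, Matrix.of_apply, hl, hr, hUA, hWA, hZA,
      ← ofFn_val_eq_map_range]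
  refine Primrec.of_eq ?_ fun n => (hcode n).symm
  have hrange : Primrec fun n => List.range (n + 1) := Primrec.list_range.comp Primrec.succ
  refine Primrec.list_append.comp (Primrec.list_ofFn fun i => ?_) (Primrec.list_map hrange ?_)
  · exact Primrec.list_append.comp (Primrec.list_ofFn fun j => hT _ _)
      (Primrec.list_map hrange (hU _))
  · refine Primrec.list_append.comp (Primrec.list_ofFn fun j => hW _) (Primrec.list_map ?_ ?_)
    · exact hrange.comp Primrec.fst
    · exact hZ

theorem primrec_two_pow_succ : Primrec fun n : ℕ => 2 ^ (n + 1) :=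
  (Primrec₂.unpaired'.1 Nat.Primrec.pow).comp (Primrec.const 2) Primrec.succ

theorem primrecFamily_initMat : PrimrecFamily fun n => initMat (Q := Q) (V := V) n := by
  have hu : Primrec₂ fun n i : ℕ => if i = 0 then 2 ^ (n + 1) else 0 :=
    Primrec.ite (Primrec.eq.comp Primrec.snd (Primrec.const 0))
      (primrec_two_pow_succ.comp Primrec.fst) (Primrec.const 0)
  refine ⟨fun _ _ => Primrec.const 0, fun _ => ⟨_, hu, fun n i => ?_⟩,
    fun _ => ⟨fun _ _ => 0, Primrec.const 0, fun _ _ => rfl⟩,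
    ⟨fun p j => if j = 0 then 2 ^ (p.1 + 1) else 0, ?_, fun n i j => ?_⟩⟩
  · simp [initMat]
  · exact hu.comp (Primrec.fst.comp Primrec.fst) Primrec.snd
  · simp [initMat]

theorem primrecFamily_adamMat (S : Q → Instr V Q) (q₀ : Q) {x₀ : ℕ → V → ℕ}
    (hx₀ : ∀ r, Primrec fun n => x₀ n r) (a : Bool) :
    PrimrecFamily fun n => adamMat S q₀ n (x₀ n) a := by
  have hs (κ : Coord V) : Primrec fun n => startCoeff n (x₀ n) κ := by
    match κ with
    | none => exact Primrec.const 1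
    | some (r, false) => exact hx₀ r
    | some (r, true) =>
      exact Primrec.nat_sub.comp (Primrec.nat_sub.comp primrec_two_pow_succ (Primrec.const 1))
        (hx₀ r)
  refine ⟨?_, ?_, ?_, ?_⟩
  · rintro ⟨⟨q, _ | b⟩, κ⟩ ⟨p, κ'⟩ <;> exact Primrec.const _
  · rintro ⟨⟨q, _ | b⟩, κ⟩
    -- These entries do not depend on `n`, so the value at `n = 0` serves as the constant.
    · refine ⟨fun _ i => if i = 0 then adamMat S q₀ 0 (x₀ 0) a (.inl ((q, none), κ)) (.inr 0)
        else 0, Primrec.ite (Primrec.eq.comp Primrec.snd (Primrec.const 0)) (Primrec.const _)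
        (Primrec.const 0), fun n i => ?_⟩
      cases hS : S q <;> simp [adamMat, hS]
    · exact ⟨fun _ _ => 0, Primrec.const 0, fun _ _ => rfl⟩
  · rintro ⟨p, κ⟩
    by_cases hp : p = (q₀, none)
    · refine ⟨fun n i => if i = n then startCoeff n (x₀ n) κ else 0,
        Primrec.ite (Primrec.eq.comp Primrec.snd Primrec.fst) ((hs κ).comp Primrec.fst)
          (Primrec.const 0), fun n i => ?_⟩
      simp [adamMat, hp]
    · exact ⟨fun _ _ => 0, Primrec.const 0, fun n i => by simp [adamMat, hp]⟩
  · exact ⟨fun p j => if j = p.2 + 1 then 1 else 0,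
      Primrec.ite (Primrec.eq.comp Primrec.snd
        (Primrec.succ.comp (Primrec.snd.comp Primrec.fst))) (Primrec.const 1) (Primrec.const 0),
      fun _ _ _ => rfl⟩

theorem primrecFamily_eveMat (S : Q → Instr V Q) (e : Bool) :
    PrimrecFamily fun n => eveMat S n e := by
  refine ⟨fun _ _ => Primrec.const _, fun _ => ⟨fun _ _ => 0, Primrec.const 0, fun _ _ => rfl⟩,
    fun _ => ⟨fun _ _ => 0, Primrec.const 0, fun _ _ => rfl⟩,
    ⟨fun p j => if j = p.2 then 1 else 0, ?_, fun n i j => ?_⟩⟩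
  · exact Primrec.ite (Primrec.eq.comp Primrec.snd (Primrec.snd.comp Primrec.fst))
      (Primrec.const 1) (Primrec.const 0)
  · simp [eveMat, Fin.ext_iff]

/-- The code of the game of an alternating counter system. -/
noncomputable def systemCode (S : Q → Instr V Q) (q₀ : Q) (x₀ : ℕ → V → ℕ) (n : ℕ) : GameCode :=
  (gameDim Q V n, gameDim Q V n, (adamList S q₀ n (x₀ n)).map matrixCode,
    (eveList S n).map matrixCode)

theorem isCodeOf_systemCode (S : Q → Instr V Q) (q₀ : Q) (x₀ : ℕ → V → ℕ) (n : ℕ) :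
    IsCodeOf (systemCode S q₀ x₀ n) (systemGame S q₀ n (x₀ n)) :=
  ⟨adamList S q₀ n (x₀ n), eveList S n, fun _ => List.mem_toFinset.symm,
    fun _ => List.mem_toFinset.symm, rfl⟩

theorem primrec_systemCode (S : Q → Instr V Q) (q₀ : Q) {x₀ : ℕ → V → ℕ}
    (hx₀ : ∀ r, Primrec fun n => x₀ n r) : Primrec (systemCode S q₀ x₀) := by
  have hdim : Primrec fun n => gameDim Q V n :=
    Primrec.nat_add.comp (Primrec.const _) Primrec.succ
  have hA (a : Bool) := (primrecFamily_adamMat S q₀ hx₀ a).primrec_matrixCode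
  have hE (e : Bool) := (primrecFamily_eveMat S e).primrec_matrixCode
  have hI := (primrecFamily_initMat (Q := Q) (V := V)).primrec_matrixCode
  have hnil : Primrec fun _ : ℕ => ([] : List (List (List ℕ))) := Primrec.const []
  exact hdim.pair (hdim.pair
    ((Primrec.list_cons.comp hI (Primrec.list_cons.comp (hA true)
      (Primrec.list_cons.comp (hA false) hnil))).pair
    (Primrec.list_cons.comp (hE true) (Primrec.list_cons.comp (hE false) hnil))))

end Code

end MMG

theorem mainTheorem8 :
    ¬ ComputablePred fun c : MMG.GameCode =>
      ∃ G : MMG.NatGame, MMG.IsCodeOf c G ∧ G.maxEvePayoff < 2 := by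
  classical
  intro hc
  obtain ⟨R, Q, hQ, S, q₀, hS⟩ := MMG.exists_undecidable_finite_system
  have := Fintype.ofFinite Q
  let x₀ : ℕ → Fin (R + 1) → ℕ := fun n i => if i = 0 then n else 0
  have hx₀ : ∀ r, Primrec fun n => x₀ n r := fun r => by
    by_cases h : r = 0
    · simp only [x₀, h, if_true]
      exact Primrec.id
    · simp only [x₀, h, if_false]
      exact Primrec.const 0
  refine hS ((MMG.computablePred_comp hc (MMG.primrec_systemCode S q₀ hx₀).to_comp).of_eq
    fun n => ?_)
  -- The chain length follows the input, so the starting scale exceeds it.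
  have hlt : ∀ r, x₀ n r < 2 ^ (n + 1) := fun r => by
    have h1 : n < 2 ^ n := Nat.lt_two_pow_self
    have h2 : 2 ^ (n + 1) = 2 * 2 ^ n := by ring
    simp only [x₀]
    split_ifs <;> omega
  have hcode := MMG.isCodeOf_systemCode S q₀ x₀ n
  rw [← MMG.maxEvePayoff_lt_two_iff (S := S) (q₀ := q₀) hlt]
  constructor
  · rintro ⟨G, hG, hv⟩
    -- A code determines its game, so the existential over games speaks about the system's game.
    rwa [hG.unique hcode] at hv
  · exact fun hv => ⟨_, hcode, hv⟩
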